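/- Let $\langle S,A,P,\mu,\mathbf r,\gamma\rangle$ be a tabular multi-objective MDP: $S$ and $A$ are finite and nonempty, $P(\cdot|s,a)$ and $\mu$ are probability distributions on $S$, $\mathbf r=(r_1,\dots,r_K):S\times A\to\mathbb R^K$, $\gamma\in(0,1)$. Assume that every state is reachable with positive probability from the initial distribution $\mu$ under a suitable choice of actions. For a policy $\pi:S\to\Delta(A)$ and $\tau>0$ put $$V^\pi_k=\mathbb E_{\mu,\pi}\Big[\sum_{t\ge0}\gamma^t r_k(s_t,a_t)\Big],\quad V^\pi_{k,\tau}=\mathbb E_{\mu,\pi}\Big[\sum_{t\ge0}\gamma^t\big(r_k(s_t,a_t)-\tau\log\pi(a_t|s_t)\big)\Big],\quad \tilde H(\pi)=\mathbb E_{\mu,\pi}\Big[-\sum_{t\ge0}\gamma^t\log\pi(a_t|s_t)\Big],$$ and for $w\in\Delta^K=\{w\in\mathbb R^K: w(k)\ge0,\ \sum_k w(k)=1\}$ let $$Q^\pi_{w,\tau}(s,a)=\langle w,\mathbf r(s,a)\rangle+\gamma\sum_{s'}P(s'|s,a)V^\pi_{w,\tau}(s'),\qquad V^\pi_{w,\tau}(s)=\mathbb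 E_\pi\Big[\sum_{t\ge0}\gamma^t\big(\langle w,\mathbf r(s_t,a_t)\rangle-\tau\log\pi(a_t|s_t)\big)\,\Big|\,s_0=s\Big].$$ Policies are parametrized by softmax: $\pi_\theta(a|s)=e^{\theta_{sa}}/\sum_{a'}e^{\theta_{sa'}}$, $\theta\in\mathbb R^{S\times A}$. Let $\tau_w>0$ satisfy $$\tau_w\ \ge\ \frac{12K\big(\max_{s,a,k}|r_k(s,a)|+\tau\log|A|\big)^2}{\tau(1-\gamma)^4}.$$ Let $(\theta^*,w^*)$, with $\pi^*=\pi_{\theta^*}$, be a Nash equilibrium of the zero-sum game in which the Learner chooses $\theta\in\mathbb R^{S\times A}$ to maximize $$u(\theta,w)=\sum_k w(k)V_k^{\pi_\theta}+\tau\tilde H(\pi_\theta)-\tau_wH(w),\qquad H(w)=-\sum_k w(k)\log w(k),$$ and the Adversary chooses $w\in\Delta^K$ to maximize $-u(\theta,w)$. ERAM with exact policy evaluation and step sizes $\eta,\lambda>0$ starts from $\theta_0\in\mathbb R^{S\times A}$ and $w_0\in\Delta^K$ with all $w_0(k)>0$ and iterates $$\theta_{t+1}=\theta_t+\eta F(\theta_t)^\dagger\sum_{k=1}^K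 w_t(k)\nabla_\theta V^{\pi_{\theta_t}}_{k,\tau},\qquad w_{t+1}=\mathrm{softmax}\Big(-\frac{1-\beta}{\tau_w}\mathbf V^{\pi_{\theta_t}}+\beta\log w_t\Big),\qquad \beta=\frac1{\lambda\tau_w+1},$$ where $\mathbf V^\pi=(V_1^\pi,\dots,V_K^\pi)$, $F(\theta)=\mathbb E_{(s,a)\sim d^{\pi_\theta}}[\nabla_\theta\log\pi_\theta(a|s)\,\nabla_\theta\log\pi_\theta(a|s)^{T}]$ is the Fisher information matrix, $d^\pi(s,a)=(1-\gamma)\sum_{t\ge0}\gamma^t\Pr^\pi_\mu(s_t=s)\,\pi(a|s)$, and $\dagger$ is the Moore–Penrose pseudo-inverse. Write $\pi_t=\pi_{\theta_t}$. Then there is a constant $C>0$, which may depend on the MDP, $\tau$, $\tau_w$, $\theta_0$, $w_0$ and the equilibrium but not on $\epsilon$ or $\epsilon_{acc}$, such that for every $\epsilon$ with $$0<\epsilon<\epsilon_0:=\frac{2(1-\gamma)}{4+5\gamma-6\gamma^2}$$ and every $\epsilon_{acc}\in(0,\tfrac12]$, ERAM with $\eta=\frac{\epsilon(1-\gamma)}{\tau}$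 and $\lambda=\frac{\epsilon^2}{\tau_w(1-\epsilon^2)}$ satisfies, for some integer $N\le\frac{C}{\epsilon^2}\log\frac1{\epsilon_{acc}}$ and all $t\ge N$, $$\|\log\pi^*-\log\pi_t\|_\infty\le\epsilon_{acc},\qquad \|w^*-w_t\|_\infty\le\epsilon_{acc},\qquad \|Q^{\pi^*}_{w^*,\tau}-Q^{\pi_t}_{w_t,\tau}\|_\infty\le\epsilon_{acc}.$$ -/

import Mathlib

noncomputable section

/-! Moore-Penrose pseudo-inverse of a real matrix. -/

/-- `X` satisfies the four Penrose conditions for the real matrix `A`. -/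
structure IsMoorePenrose {m n : Type*} [Fintype m] [Fintype n]
    (A : Matrix m n ℝ) (X : Matrix n m ℝ) : Prop where
  mul_mul_self : A * X * A = A
  self_mul_mul : X * A * X = X
  left_symm : (A * X).transpose = A * X
  right_symm : (X * A).transpose = X * A

theorem exists_isMoorePenrose_of_symm {n : Type*} [Fintype n] [DecidableEq n] (A : Matrix n n ℝ)
    (hA : A.IsHermitian) : ∃ X : Matrix n n ℝ, IsMoorePenrose A X ∧ X.transpose = X := by
  have h := hA.spectral_theorem
  set U := hA.eigenvectorUnitary
  rw [Unitary.conjStarAlgAut_apply] at h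
  obtain ⟨V, hVe⟩ : ∃ V : Matrix n n ℝ, V = (U : Matrix n n ℝ) := ⟨_, rfl⟩
  have hV : V.transpose * V = 1 := by
    have : star (U : Matrix n n ℝ) * U = 1 := by simp
    rw [← hVe] at this
    simpa [Matrix.star_eq_conjTranspose] using this
  obtain ⟨d, hd⟩ : ∃ d : n → ℝ, A = V * Matrix.diagonal d * V.transpose :=
    ⟨hA.eigenvalues, by
      simpa [Function.comp_def, hVe, Matrix.star_eq_conjTranspose] using h⟩
  have key : ∀ D E : Matrix n n ℝ,
      V * D * V.transpose * (V * E * V.transpose) = V * (D * E) * V.transpose := by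
    intro D E
    calc _ = V * D * (V.transpose * V) * E * V.transpose := by simp only [Matrix.mul_assoc]
      _ = _ := by rw [hV]; simp only [Matrix.mul_assoc, Matrix.one_mul]
  have tr : ∀ f : n → ℝ, (V * Matrix.diagonal f * V.transpose).transpose
      = V * Matrix.diagonal f * V.transpose := by
    intro f; simp [Matrix.transpose_mul, Matrix.mul_assoc]
  refine ⟨V * Matrix.diagonal (fun i => (d i)⁻¹) * V.transpose, ⟨?_, ?_, ?_, ?_⟩, tr _⟩
  · rw [hd, key, key, Matrix.diagonal_mul_diagonal, Matrix.diagonal_mul_diagonal]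
    simp only [mul_inv_mul_cancel]
  · rw [hd, key, key, Matrix.diagonal_mul_diagonal, Matrix.diagonal_mul_diagonal]
    congr 3; funext i
    by_cases h0 : d i = 0 <;> simp [h0]
  · rw [hd, key, Matrix.diagonal_mul_diagonal, tr]
  · rw [hd, key, Matrix.diagonal_mul_diagonal, tr]

theorem exists_isMoorePenrose {m n : Type*} [Fintype m] [Fintype n] (A : Matrix m n ℝ) :
    ∃ X, IsMoorePenrose A X := by
  classical
  obtain ⟨B, hB, hBs⟩ := exists_isMoorePenrose_of_symm (A.transpose * A) (by
    simp [Matrix.IsHermitian, Matrix.transpose_mul])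
  obtain ⟨G, hG⟩ : ∃ G, G = A.transpose * A := ⟨_, rfl⟩
  rw [← hG] at hB
  have hZ : A * (B * G) - A = 0 := by
    rw [← Matrix.conjTranspose_mul_self_eq_zero]
    calc _ = ((B * G - 1).transpose * (G * B * G - G)) := by
          simp only [hG, Matrix.conjTranspose_eq_transpose_of_trivial, Matrix.transpose_sub,
            Matrix.transpose_mul, Matrix.transpose_one, Matrix.sub_mul, Matrix.mul_sub,
            Matrix.mul_assoc, Matrix.one_mul, Matrix.transpose_transpose]
      _ = 0 := by rw [hB.mul_mul_self, sub_self, Matrix.mul_zero]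
  refine ⟨B * A.transpose, ?_, ?_, ?_, ?_⟩
  · rw [sub_eq_zero] at hZ
    simpa [hG, Matrix.mul_assoc] using hZ
  · have := congrArg (fun Y => Y * A.transpose) hB.self_mul_mul
    simpa [hG, Matrix.mul_assoc] using this
  · simp [Matrix.transpose_mul, hBs, Matrix.mul_assoc]
  · simpa [hG, Matrix.mul_assoc] using hB.right_symm

theorem IsMoorePenrose.unique {m n : Type*} [Fintype m] [Fintype n] {A : Matrix m n ℝ}
    {X Y : Matrix n m ℝ} (hX : IsMoorePenrose A X) (hY : IsMoorePenrose A Y) : X = Y := by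
  have h1 : A * X = A * Y := by
    calc A * X = (A * X).transpose := hX.left_symm.symm
      _ = ((A * Y) * (A * X)).transpose := by rw [← Matrix.mul_assoc, hY.mul_mul_self]
      _ = (A * X) * (A * Y) := by rw [Matrix.transpose_mul, hX.left_symm, hY.left_symm]
      _ = A * Y := by rw [← Matrix.mul_assoc, hX.mul_mul_self]
  have h2 : X * A = Y * A := by
    calc X * A = (X * A).transpose := hX.right_symm.symm
      _ = ((X * A) * (Y * A)).transpose := by
          rw [Matrix.mul_assoc, ← Matrix.mul_assoc A, hY.mul_mul_self]
      _ = (Y * A) * (X * A) := by rw [Matrix.transpose_mul, hX.right_symm, hY.right_symm]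
      _ = Y * A := by rw [Matrix.mul_assoc, ← Matrix.mul_assoc A, hX.mul_mul_self]
  calc X = X * A * X := hX.self_mul_mul.symm
    _ = Y * A * Y := by rw [h2, Matrix.mul_assoc, h1, ← Matrix.mul_assoc]
    _ = Y := hY.self_mul_mul

/-- The Moore-Penrose pseudo-inverse. -/
def pinv {m n : Type*} [Fintype m] [Fintype n] (A : Matrix m n ℝ) : Matrix n m ℝ :=
  Classical.choose (exists_isMoorePenrose A)

theorem pinv_spec {m n : Type*} [Fintype m] [Fintype n] (A : Matrix m n ℝ) :
    IsMoorePenrose A (pinv A) :=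
  Classical.choose_spec (exists_isMoorePenrose A)

/-- `softmax x i = exp (x i) / ∑ j, exp (x j)`. -/
def softmax {ι : Type*} [Fintype ι] (x : ι → ℝ) : ι → ℝ :=
  fun i => Real.exp (x i) / ∑ j, Real.exp (x j)

/-- Vector of partial derivatives of a function of finitely many real variables. -/
def coordGrad {ι : Type*} [Fintype ι] [DecidableEq ι] (f : (ι → ℝ) → ℝ) (x : ι → ℝ) : ι → ℝ :=
  fun i => fderiv ℝ f x (Pi.single i 1)

/-- Shannon entropy of a weight vector (with `0 log 0 = 0`). -/
def shannonEntropy {K : ℕ} (w : Fin K → ℝ) : ℝ := ∑ k, Real.negMulLog (w k)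

/-- A tabular multi-objective Markov decision process with finite state space `S`, finite action
space `A` and `K` objectives. `P s a s'` is the probability of moving to `s'` from `s` under `a`. -/
structure MOMDP (S A : Type*) [Fintype S] [Fintype A] (K : ℕ) where
  P : S → A → S → ℝ
  P_mem : ∀ s a, P s a ∈ stdSimplex ℝ S
  μ : S → ℝ
  μ_mem : μ ∈ stdSimplex ℝ S
  r : S → A → Fin K → ℝ
  γ : ℝ
  γ_pos : 0 < γ
  γ_lt_one : γ < 1

/-- Tabular softmax policy: `softmaxPolicy θ s a = exp (θ (s, a)) / ∑ a', exp (θ (s, a'))`. -/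
def softmaxPolicy {S A : Type*} [Fintype A] (θ : S × A → ℝ) : S → A → ℝ :=
  fun s => softmax (fun a => θ (s, a))

namespace MOMDP

variable {S A : Type*} [Fintype S] [Fintype A] {K : ℕ} (M : MOMDP S A K)

/-- Every state can be reached with positive probability from the initial distribution by a
suitable choice of actions. -/
def AllReachable : Prop :=
  ∀ s, ∃ s₀, 0 < M.μ s₀ ∧ Relation.ReflTransGen (fun x y => ∃ a, 0 < M.P x a y) s₀ s

/-- `max_{s,a,k} |r_k(s,a)|`. -/
def rMax : ℝ := ⨆ x : S × A × Fin K, |M.r x.1 x.2.1 x.2.2|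

/-- Law of the state at time `t` when the initial state has law `ν` and actions follow `π`. -/
def stateLaw (π : S → A → ℝ) (ν : S → ℝ) : ℕ → S → ℝ
  | 0 => ν
  | t + 1 => fun s' => ∑ s, stateLaw π ν t s * ∑ a, π s a * M.P s a s'

/-- Expected discounted return `𝔼_{ν,π} [∑ t, γ ^ t * c (s_t, a_t)]`. -/
def discountedReturn (π : S → A → ℝ) (ν : S → ℝ) (c : S → A → ℝ) : ℝ :=
  ∑' t : ℕ, M.γ ^ t * ∑ s, M.stateLaw π ν t s * ∑ a, π s a * c s a

/-- `V_k^π`. -/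
def value (π : S → A → ℝ) (k : Fin K) : ℝ :=
  M.discountedReturn π M.μ (fun s a => M.r s a k)

/-- Expected cumulative discounted entropy of a policy. -/
def policyEntropy (π : S → A → ℝ) : ℝ :=
  M.discountedReturn π M.μ (fun s a => -Real.log (π s a))

/-- `V_{k,τ}^π`, the entropy-regularized value of objective `k`. -/
def softValue (τ : ℝ) (π : S → A → ℝ) (k : Fin K) : ℝ :=
  M.discountedReturn π M.μ (fun s a => M.r s a k - τ * Real.log (π s a))

variable [DecidableEq S]

/-- `V_{w,τ}^π(s)`, the soft state value for the scalar reward `⟨w, r⟩`. -/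
def softStateValue (τ : ℝ) (w : Fin K → ℝ) (π : S → A → ℝ) (s : S) : ℝ :=
  M.discountedReturn π (Pi.single s 1)
    (fun s' a' => ∑ k, w k * M.r s' a' k - τ * Real.log (π s' a'))

/-- `Q_{w,τ}^π(s,a)`, the soft action value for the scalar reward `⟨w, r⟩`. -/
def softQ (τ : ℝ) (w : Fin K → ℝ) (π : S → A → ℝ) (s : S) (a : A) : ℝ :=
  ∑ k, w k * M.r s a k + M.γ * ∑ s', M.P s a s' * M.softStateValue τ w π s'

/-- Normalized discounted state visitation distribution under `π` from the initial law. -/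
def visitation (π : S → A → ℝ) (s : S) : ℝ :=
  (1 - M.γ) * ∑' t : ℕ, M.γ ^ t * M.stateLaw π M.μ t s

/-- Learner's payoff in the regularized two-player zero-sum game; Adversary's is its negative. -/
def gameUtility (τ τw : ℝ) (θ : S × A → ℝ) (w : Fin K → ℝ) : ℝ :=
  ∑ k, w k * M.value (softmaxPolicy θ) k + τ * M.policyEntropy (softmaxPolicy θ)
    - τw * shannonEntropy w

/-- `(θ, w)` is a Nash equilibrium of the regularized game, in which Learner plays a softmax
parameter, maximizing `gameUtility`, and Adversary plays a weight in the simplex, maximizing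
`-gameUtility`. -/
def IsNash (τ τw : ℝ) (θ : S × A → ℝ) (w : Fin K → ℝ) : Prop :=
  w ∈ stdSimplex ℝ (Fin K) ∧
  (∀ θ', M.gameUtility τ τw θ' w ≤ M.gameUtility τ τw θ w) ∧
  (∀ w' ∈ stdSimplex ℝ (Fin K), -M.gameUtility τ τw θ w' ≤ -M.gameUtility τ τw θ w)

variable [DecidableEq A]

/-- Fisher information matrix `𝔼_{(s,a) ∼ d^{π_θ}} [∇ log π_θ(a|s) (∇ log π_θ(a|s))ᵀ]`. -/
def fisher (θ : S × A → ℝ) : Matrix (S × A) (S × A) ℝ :=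
  ∑ s, ∑ a, (M.visitation (softmaxPolicy θ) s * softmaxPolicy θ s a) •
    Matrix.vecMulVec (coordGrad (fun θ' => Real.log (softmaxPolicy θ' s a)) θ)
      (coordGrad (fun θ' => Real.log (softmaxPolicy θ' s a)) θ)

/-- Natural policy gradient step
`θ + η F(θ)† ∑ k, w k ∇_θ V_{k,τ}^{π_θ}`. -/
def npgStep (τ η : ℝ) (θ : S × A → ℝ) (w : Fin K → ℝ) : S × A → ℝ :=
  θ + η • (pinv (M.fisher θ)).mulVec
    (∑ k, w k • coordGrad (fun θ' => M.softValue τ (softmaxPolicy θ') k) θ)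

/-- Mirror descent step on the weight, with `β = 1 / (lam * τw + 1)`:
`softmax (-(1 - β) / τw * V^{π_θ} + β * log w)`. -/
def weightStep (τw lam : ℝ) (θ : S × A → ℝ) (w : Fin K → ℝ) : Fin K → ℝ :=
  softmax (fun k => -((1 - 1 / (lam * τw + 1)) / τw) * M.value (softmaxPolicy θ) k
    + 1 / (lam * τw + 1) * Real.log (w k))

/-- The iterates `(θ_t, w_t)` of ERAM with exact policy evaluation, started at `(θ₀, w₀)`;
both players update simultaneously. -/
def eram (τ τw η lam : ℝ) (θ₀ : S × A → ℝ) (w₀ : Fin K → ℝ) : ℕ → (S × A → ℝ) × (Fin K → ℝ)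
  | 0 => (θ₀, w₀)
  | t + 1 =>
    (M.npgStep τ η (eram τ τw η lam θ₀ w₀ t).1 (eram τ τw η lam θ₀ w₀ t).2,
      M.weightStep τw lam (eram τ τw η lam θ₀ w₀ t).1 (eram τ τw η lam θ₀ w₀ t).2)

end MOMDP

end

/-! In logarithmic coordinates ERAM is a pair of averaging recursions. By the policy gradient
theorem `∇V` is `F(θ)` applied to the soft advantage, divided by `1 - γ`. Since every state is
visited, the kernel of `F(θ)` consists of shifts constant in each state, which softmax ignores. So
if `π = softmax (z / τ)` and `w = softmax ζ`, one iteration is `z ↦ (1 - ε) z + ε Q` and `ζ ↦ (1 -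
ε²) ζ + ε² (-V / τw)`. At a Nash equilibrium both players are Gibbs responses, so `(Q*, -V*/τw)` is
the fixed point.

With `g = 1 - γ` and `R` a bound on the rewards, three bounds are carried together (`LogClose`):
`|Q* - z| ≤ L`, `|ζ* - ζ| ≤ L g² / (4R)`, and the one-sided defect `z - Q ≤ L g / 2`. The defect
controls how far `Q` lies below `Q*` (`softQ_greedy_sub_le`). The soft optimality of `π*` controls
the other side (`softQ_le_of_greedy`). The defect itself survives a step because mixing towards `Q`
is a policy improvement (`softQ_sub_le_of_interpolation`): `Q` can drop only through the drift of
the weights, which is of order `ε²` while the defect shrinks at rate `ε`. Softmax is 1-Lipschitz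
from sup norm to `ℓ¹` (`sum_abs_softmax_sub_le`), and a large `τw` makes the feedback of the policy
on the weights small. Hence `LogClose.step` shrinks `L` by the factor `1 - g ε² / 4`, which gives
the `ε⁻² log (1 / εacc)` rate. -/

noncomputable section

/-! ### Softmax: the Gibbs variational principle and Lipschitz bounds. -/

section Softmax

variable {ι : Type*} [Fintype ι]

theorem sum_exp_pos [Nonempty ι] (x : ι → ℝ) : 0 < ∑ j, Real.exp (x j) :=
  Finset.sum_pos (fun _ _ => Real.exp_pos _) Finset.univ_nonempty

theorem softmax_pos [Nonempty ι] (x : ι → ℝ) (i : ι) : 0 < softmax x i :=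
  div_pos (Real.exp_pos _) (sum_exp_pos x)

theorem softmax_sum [Nonempty ι] (x : ι → ℝ) : ∑ i, softmax x i = 1 := by
  simp only [softmax, ← Finset.sum_div]
  exact div_self (sum_exp_pos x).ne'

theorem softmax_mem_stdSimplex [Nonempty ι] (x : ι → ℝ) : softmax x ∈ stdSimplex ℝ ι :=
  ⟨fun i => (softmax_pos x i).le, softmax_sum x⟩

theorem log_softmax [Nonempty ι] (x : ι → ℝ) (i : ι) :
    Real.log (softmax x i) = x i - Real.log (∑ j, Real.exp (x j)) := by
  rw [softmax, Real.log_div (Real.exp_pos _).ne' (sum_exp_pos x).ne', Real.log_exp]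

theorem softmax_congr_add {x y : ι → ℝ} (c : ℝ) (h : ∀ i, x i = y i + c) :
    softmax x = softmax y := by
  funext i
  simp only [softmax, h, Real.exp_add, ← Finset.sum_mul]
  exact mul_div_mul_right _ _ (Real.exp_pos c).ne'

theorem softmax_log {w : ι → ℝ} (hw : ∑ i, w i = 1) (hpos : ∀ i, 0 < w i) :
    softmax (fun i => Real.log (w i)) = w := by
  funext i
  simp [softmax, Real.exp_log (hpos _), hw]

/-- Gibbs' variational identity, with the Kullback-Leibler defect made explicit. -/
theorem sum_mul_add_negMulLog [Nonempty ι] (x : ι → ℝ) {p : ι → ℝ} (hp : p ∈ stdSimplex ℝ ι) :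
    ∑ i, p i * x i + ∑ i, Real.negMulLog (p i) = Real.log (∑ j, Real.exp (x j))
      - ∑ i, softmax x i * InformationTheory.klFun (p i / softmax x i) := by
  have key : ∀ i, softmax x i * InformationTheory.klFun (p i / softmax x i)
      = -Real.negMulLog (p i) - p i * (x i - Real.log (∑ j, Real.exp (x j)))
        + softmax x i - p i := by
    intro i
    have hs := softmax_pos x i
    rcases (hp.1 i).eq_or_lt with h0 | h0
    · simp [← h0, InformationTheory.klFun_zero]
    · rw [InformationTheory.klFun, Real.log_div h0.ne' hs.ne', log_softmax, Real.negMulLog]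
      field_simp
  rw [Finset.sum_congr rfl fun i _ => key i]
  simp only [Finset.sum_add_distrib, Finset.sum_sub_distrib, mul_sub, ← Finset.sum_mul,
    Finset.sum_neg_distrib, softmax_sum, hp.2]
  ring

theorem sum_mul_add_negMulLog_le [Nonempty ι] (x : ι → ℝ) {p : ι → ℝ} (hp : p ∈ stdSimplex ℝ ι) :
    ∑ i, p i * x i + ∑ i, Real.negMulLog (p i) ≤ Real.log (∑ j, Real.exp (x j)) := by
  rw [sum_mul_add_negMulLog x hp, sub_le_self_iff]
  exact Finset.sum_nonneg fun i _ => mul_nonneg (softmax_pos x i).le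
    (InformationTheory.klFun_nonneg (div_nonneg (hp.1 i) (softmax_pos x i).le))

/-- Equality in the Gibbs inequality forces every term of the Kullback-Leibler defect to vanish, and
`klFun` vanishes only at `1`. This uniqueness identifies the equilibrium strategies. -/
theorem eq_softmax_of_le [Nonempty ι] (x : ι → ℝ) {p : ι → ℝ} (hp : p ∈ stdSimplex ℝ ι)
    (h : Real.log (∑ j, Real.exp (x j)) ≤ ∑ i, p i * x i + ∑ i, Real.negMulLog (p i)) :
    p = softmax x := by
  have hnn : ∀ i ∈ Finset.univ,
      0 ≤ softmax x i * InformationTheory.klFun (p i / softmax x i) := fun i _ =>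
    mul_nonneg (softmax_pos x i).le
      (InformationTheory.klFun_nonneg (div_nonneg (hp.1 i) (softmax_pos x i).le))
  rw [sum_mul_add_negMulLog x hp] at h
  have h0 := (Finset.sum_eq_zero_iff_of_nonneg hnn).1
    (le_antisymm (by linarith) (Finset.sum_nonneg hnn))
  funext i
  have hs := softmax_pos x i
  have h1 := (mul_eq_zero.1 (h0 i (Finset.mem_univ i))).resolve_left hs.ne'
  rw [InformationTheory.klFun_eq_zero_iff (div_nonneg (hp.1 i) hs.le)] at h1
  exact (div_eq_one_iff_eq hs.ne').1 h1

theorem sum_softmax_mul_add_negMulLog [Nonempty ι] (x : ι → ℝ) :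
    ∑ i, softmax x i * x i + ∑ i, Real.negMulLog (softmax x i)
      = Real.log (∑ j, Real.exp (x j)) := by
  rw [sum_mul_add_negMulLog x (softmax_mem_stdSimplex x), sub_eq_self]
  exact Finset.sum_eq_zero fun i _ => by
    rw [div_self (softmax_pos x i).ne', InformationTheory.klFun_one, mul_zero]

theorem log_sum_exp_le [Nonempty ι] {x y : ι → ℝ} {e : ℝ} (h : ∀ i, x i ≤ y i + e) :
    Real.log (∑ j, Real.exp (x j)) ≤ Real.log (∑ j, Real.exp (y j)) + e := by
  conv_rhs => rw [← Real.log_exp e, ← Real.log_mul (sum_exp_pos y).ne' (Real.exp_pos _).ne',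
    Finset.sum_mul]
  refine Real.log_le_log (sum_exp_pos x) (Finset.sum_le_sum fun i _ => ?_)
  rw [← Real.exp_add]
  exact Real.exp_le_exp.2 (h i)

theorem abs_log_softmax_sub_le [Nonempty ι] {x y : ι → ℝ} {e : ℝ} (h : ∀ i, |x i - y i| ≤ e)
    (i : ι) : |Real.log (softmax x i) - Real.log (softmax y i)| ≤ 2 * e := by
  have h1 := log_sum_exp_le (x := x) (y := y) (e := e) fun i => by linarith [(abs_le.1 (h i)).2]
  have h2 := log_sum_exp_le (x := y) (y := x) (e := e) fun i => by linarith [(abs_le.1 (h i)).1]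
  have h3 := abs_le.1 (h i)
  rw [log_softmax, log_softmax, abs_le]
  constructor <;> linarith

/-- The logarithmic mean is at most the arithmetic mean; for `p ≥ q` this is `log (1 + x) ≥ 2x / (x
+ 2)` at `x = p / q - 1`. -/
theorem two_mul_sq_sub_div_add_le {p q : ℝ} (hp : 0 < p) (hq : 0 < q) :
    2 * ((p - q) ^ 2 / (p + q)) ≤ (p - q) * (Real.log p - Real.log q) := by
  wlog hpq : q ≤ p generalizing p q
  · have := this hq hp (not_le.1 hpq).le
    rw [add_comm p q]
    calc _ = 2 * ((q - p) ^ 2 / (q + p)) := by ring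
      _ ≤ _ := this
      _ = _ := by ring
  have h := Real.le_log_one_add_of_nonneg (x := p / q - 1) (by
    rw [sub_nonneg, le_div_iff₀ hq]; linarith)
  have e1 : 2 * (p / q - 1) / (p / q - 1 + 2) = 2 * (p - q) / (p + q) := by
    have h1 : p / q - 1 + 2 = (p + q) / q := by field_simp; ring
    have h2 : p / q - 1 = (p - q) / q := by field_simp
    rw [h1, h2]
    field_simp
  rw [e1, add_sub_cancel, Real.log_div hp.ne' hq.ne'] at h
  calc _ = (p - q) * (2 * (p - q) / (p + q)) := by ring
    _ ≤ _ := mul_le_mul_of_nonneg_left h (sub_nonneg.2 hpq)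

/-- The softmax map is `1`-Lipschitz from the sup norm to the `ℓ¹` norm. -/
theorem sum_abs_softmax_sub_le [Nonempty ι] {x y : ι → ℝ} {e : ℝ} (h : ∀ i, |x i - y i| ≤ e) :
    ∑ i, |softmax x i - softmax y i| ≤ e := by
  set p := softmax x with hp
  set q := softmax y with hq
  have hpp : ∀ i, 0 < p i := softmax_pos x
  have hqp : ∀ i, 0 < q i := softmax_pos y
  set n := ∑ i, |p i - q i| with hn
  have hn0 : 0 ≤ n := Finset.sum_nonneg fun _ _ => abs_nonneg _
  -- Cauchy-Schwarz with weights `p + q`, whose total mass is `2`; this matches the factor `2` in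
  -- `two_mul_sq_sub_div_add_le`, so the symmetrized divergence dominates `n ^ 2`.
  have hcs : n ^ 2 ≤ (∑ i, |p i - q i| ^ 2 / (p i + q i)) * ∑ i, (p i + q i) := by
    refine Finset.sum_sq_le_sum_mul_sum_of_sq_le_mul _ (fun i _ => ?_) (fun i _ => ?_)
      fun i _ => ?_
    · exact div_nonneg (sq_nonneg _) (add_pos (hpp i) (hqp i)).le
    · exact (add_pos (hpp i) (hqp i)).le
    · rw [div_mul_cancel₀ _ (add_pos (hpp i) (hqp i)).ne']
  have hsum : ∑ i, (p i + q i) = 2 := by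
    rw [Finset.sum_add_distrib, hp, hq, softmax_sum, softmax_sum]; norm_num
  -- The log-partition functions are constant in `i` and drop out because `p - q` has total mass
  -- zero.
  have hlog : ∑ i, (p i - q i) * (Real.log (p i) - Real.log (q i))
      = ∑ i, (p i - q i) * (x i - y i) := by
    have : ∀ i, (p i - q i) * (Real.log (p i) - Real.log (q i)) = (p i - q i) * (x i - y i)
        - (p i - q i) * (Real.log (∑ j, Real.exp (x j)) - Real.log (∑ j, Real.exp (y j))) := by
      intro i
      rw [hp, hq, log_softmax, log_softmax]; ring
    rw [Finset.sum_congr rfl fun i _ => this i, Finset.sum_sub_distrib, ← Finset.sum_mul,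
      Finset.sum_sub_distrib, hp, hq, softmax_sum, softmax_sum]
    ring
  have hup : ∑ i, (p i - q i) * (x i - y i) ≤ n * e := by
    rw [hn, Finset.sum_mul]
    refine Finset.sum_le_sum fun i _ => (le_abs_self _).trans ?_
    rw [abs_mul]
    exact mul_le_mul_of_nonneg_left (h i) (abs_nonneg _)
  have hlow : n ^ 2 ≤ n * e := by
    refine hcs.trans (le_trans ?_ (hlog.symm ▸ hup))
    rw [hsum, mul_comm, Finset.mul_sum]
    exact Finset.sum_le_sum fun i _ => by
      rw [sq_abs]; exact two_mul_sq_sub_div_add_le (hpp i) (hqp i)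
  rcases hn0.eq_or_lt with h0 | h0
  · rw [← h0]
    exact (abs_nonneg _).trans (h (Classical.arbitrary ι))
  · nlinarith

end Softmax

/-! ### Discounted returns: averaging bounds, Bellman equation, performance difference. -/

/-- A function on a finite type that improves each of its upper bounds `B` to `e + γ * B` is at most
`e / (1 - γ)`. -/
theorem le_div_one_sub_of_forall_bound {S : Type*} [Finite S] {γ e : ℝ} (hγ : γ < 1) {f : S → ℝ}
    (h : ∀ B, (∀ s, f s ≤ B) → ∀ s, f s ≤ e + γ * B) (s : S) : f s ≤ e / (1 - γ) := by
  have : Nonempty S := ⟨s⟩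
  obtain ⟨m, hm⟩ := Finite.exists_max f
  have := h (f m) hm m
  refine (hm s).trans ?_
  rw [le_div_iff₀ (by linarith)]
  linarith

theorem sum_mul_le_of_mem_stdSimplex {S : Type*} [Fintype S] {p f : S → ℝ} {B : ℝ}
    (hp : p ∈ stdSimplex ℝ S) (hf : ∀ s, f s ≤ B) : ∑ s, p s * f s ≤ B := by
  calc _ ≤ ∑ s, p s * B :=
        Finset.sum_le_sum fun s _ => mul_le_mul_of_nonneg_left (hf s) (hp.1 s)
    _ = B := by rw [← Finset.sum_mul, hp.2, one_mul]

theorem abs_sum_mul_le_of_mem_stdSimplex {S : Type*} [Fintype S] {p f : S → ℝ} {B : ℝ}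
    (hp : p ∈ stdSimplex ℝ S) (hf : ∀ s, |f s| ≤ B) : |∑ s, p s * f s| ≤ B := by
  refine abs_le.2 ⟨?_, sum_mul_le_of_mem_stdSimplex hp fun s => (abs_le.1 (hf s)).2⟩
  have := sum_mul_le_of_mem_stdSimplex (f := fun s => -f s) hp
    fun s => neg_le.1 (abs_le.1 (hf s)).1
  simp only [mul_neg, Finset.sum_neg_distrib] at this
  linarith

theorem abs_sum_mul_le_sum_abs_mul {ι : Type*} [Fintype ι] {u f : ι → ℝ} {B : ℝ}
    (hf : ∀ i, |f i| ≤ B) : |∑ i, u i * f i| ≤ (∑ i, |u i|) * B := by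
  rw [Finset.sum_mul]
  refine (Finset.abs_sum_le_sum_abs _ _).trans (Finset.sum_le_sum fun i _ => ?_)
  rw [abs_mul]
  exact mul_le_mul_of_nonneg_left (hf i) (abs_nonneg _)

theorem softmaxPolicy_mem_stdSimplex {S A : Type*} [Fintype A] [Nonempty A] (θ : S × A → ℝ)
    (s : S) : softmaxPolicy θ s ∈ stdSimplex ℝ A :=
  softmax_mem_stdSimplex _

theorem softmaxPolicy_pos {S A : Type*} [Fintype A] [Nonempty A] (θ : S × A → ℝ)
    (s : S) (a : A) : 0 < softmaxPolicy θ s a :=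
  softmax_pos _ _

namespace MOMDP

variable {S A : Type*} [Fintype S] [Fintype A] {K : ℕ} (M : MOMDP S A K)

theorem one_sub_γ_pos : 0 < 1 - M.γ := sub_pos.2 M.γ_lt_one

variable {π : S → A → ℝ} {ν : S → ℝ}

theorem stateLaw_mem_stdSimplex (hπ : ∀ s, π s ∈ stdSimplex ℝ A) (hν : ν ∈ stdSimplex ℝ S)
    (t : ℕ) : M.stateLaw π ν t ∈ stdSimplex ℝ S := by
  induction t with
  | zero => exact hν
  | succ t ih =>
    refine ⟨fun s' => Finset.sum_nonneg fun s _ => mul_nonneg (ih.1 s) (Finset.sum_nonneg fun a _ =>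
      mul_nonneg ((hπ s).1 a) ((M.P_mem s a).1 s')), ?_⟩
    simp only [stateLaw]
    rw [Finset.sum_comm]
    simp_rw [← Finset.mul_sum]
    rw [← ih.2]
    refine Finset.sum_congr rfl fun s _ => ?_
    rw [Finset.sum_comm]
    simp_rw [← Finset.mul_sum, (M.P_mem s _).2, mul_one, (hπ s).2, mul_one]

theorem sum_stateLaw_succ_mul (t : ℕ) (f : S → ℝ) :
    ∑ s, M.stateLaw π ν (t + 1) s * f s
      = ∑ s, M.stateLaw π ν t s * ∑ a, π s a * ∑ s', M.P s a s' * f s' := by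
  simp only [stateLaw, Finset.sum_mul]
  rw [Finset.sum_comm]
  refine Finset.sum_congr rfl fun s _ => ?_
  simp only [Finset.mul_sum, Finset.sum_mul]
  rw [Finset.sum_comm]
  refine Finset.sum_congr rfl fun a _ => Finset.sum_congr rfl fun s' _ => by ring

theorem summable_discounted (hπ : ∀ s, π s ∈ stdSimplex ℝ A) (hν : ν ∈ stdSimplex ℝ S)
    (f : S → ℝ) : Summable fun t : ℕ => M.γ ^ t * ∑ s, M.stateLaw π ν t s * f s := by
  refine Summable.of_norm_bounded
    ((summable_geometric_of_lt_one M.γ_pos.le M.γ_lt_one).mul_right (∑ s, |f s|)) fun t => ?_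
  rw [Real.norm_eq_abs, abs_mul, abs_of_pos (pow_pos M.γ_pos t)]
  refine mul_le_mul_of_nonneg_left ?_ (pow_pos M.γ_pos t).le
  exact abs_sum_mul_le_of_mem_stdSimplex (M.stateLaw_mem_stdSimplex hπ hν t) fun s =>
    Finset.single_le_sum (f := fun s => |f s|) (fun _ _ => abs_nonneg _) (Finset.mem_univ s)

/-- The series telescopes: by `sum_stateLaw_succ_mul` each term is a difference of consecutive
discounted expectations of `v`. -/
theorem tsum_discounted_sub (hπ : ∀ s, π s ∈ stdSimplex ℝ A) (hν : ν ∈ stdSimplex ℝ S)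
    (v : S → ℝ) :
    ∑' t : ℕ, M.γ ^ t * ∑ s, M.stateLaw π ν t s *
      (v s - M.γ * ∑ a, π s a * ∑ s', M.P s a s' * v s') = ∑ s, ν s * v s := by
  have hs := M.summable_discounted hπ hν v
  have h0 := hs.tsum_eq_zero_add
  have hs' := (summable_nat_add_iff 1).2 hs
  have : ∀ t : ℕ, M.γ ^ t * ∑ s, M.stateLaw π ν t s *
      (v s - M.γ * ∑ a, π s a * ∑ s', M.P s a s' * v s')
      = M.γ ^ t * ∑ s, M.stateLaw π ν t s * v s
        - M.γ ^ (t + 1) * ∑ s, M.stateLaw π ν (t + 1) s * v s := by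
    intro t
    rw [sum_stateLaw_succ_mul]
    simp only [mul_sub, Finset.sum_sub_distrib, mul_left_comm _ M.γ, ← Finset.mul_sum]
    ring
  rw [tsum_congr this, hs.tsum_sub hs', h0, add_sub_cancel_right]
  simp [stateLaw]

/-- Performance difference: the return in terms of an arbitrary baseline `v`. -/
theorem discountedReturn_eq_add (hπ : ∀ s, π s ∈ stdSimplex ℝ A) (hν : ν ∈ stdSimplex ℝ S)
    (c : S → A → ℝ) (v : S → ℝ) :
    M.discountedReturn π ν c = ∑ s, ν s * v s + ∑' t : ℕ, M.γ ^ t * ∑ s, M.stateLaw π ν t s *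
      (∑ a, π s a * (c s a + M.γ * ∑ s', M.P s a s' * v s') - v s) := by
  rw [← M.tsum_discounted_sub hπ hν v, ← (M.summable_discounted hπ hν _).tsum_add
    (M.summable_discounted hπ hν _), discountedReturn]
  refine tsum_congr fun t => ?_
  rw [← mul_add, ← Finset.sum_add_distrib]
  congr 1
  refine Finset.sum_congr rfl fun s _ => ?_
  simp only [mul_add, Finset.sum_add_distrib, mul_left_comm _ M.γ, ← Finset.mul_sum]
  ring

theorem discountedReturn_eq_sum (hπ : ∀ s, π s ∈ stdSimplex ℝ A) (hν : ν ∈ stdSimplex ℝ S)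
    {c : S → A → ℝ} {v : S → ℝ}
    (hv : ∀ s, v s = ∑ a, π s a * (c s a + M.γ * ∑ s', M.P s a s' * v s')) :
    M.discountedReturn π ν c = ∑ s, ν s * v s := by
  rw [M.discountedReturn_eq_add hπ hν c v]
  simp [← hv]

/-- The operator `v ↦ v - γ P^π v` is injective by a maximum principle, hence surjective in finite
dimension. Its solution is then recognized as the return by `discountedReturn_eq_sum`, with no
Markov-property argument on the series. -/
theorem exists_bellman (hπ : ∀ s, π s ∈ stdSimplex ℝ A) (c : S → A → ℝ) :
    ∃ v : S → ℝ, ∀ s, v s = ∑ a, π s a * (c s a + M.γ * ∑ s', M.P s a s' * v s') := by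
  let T : (S → ℝ) →ₗ[ℝ] (S → ℝ) :=
    { toFun := fun v s => v s - M.γ * ∑ a, π s a * ∑ s', M.P s a s' * v s'
      map_add' := fun v w => by
        funext s
        simp only [Pi.add_apply, mul_add, Finset.sum_add_distrib]
        ring
      map_smul' := fun k v => by
        funext s
        simp only [Pi.smul_apply, smul_eq_mul, mul_left_comm _ k, ← Finset.mul_sum, RingHom.id_apply,
          mul_sub] }
  have hle : ∀ v : S → ℝ, T v = 0 → ∀ s, v s ≤ 0 := by
    intro v hv s
    have := le_div_one_sub_of_forall_bound (e := 0) (f := v) M.γ_lt_one (fun B hB s => by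
      have h0 := congrFun hv s
      have h1 : ∑ a, π s a * ∑ s', M.P s a s' * v s' ≤ B :=
        sum_mul_le_of_mem_stdSimplex (hπ s) fun a => sum_mul_le_of_mem_stdSimplex (M.P_mem s a) hB
      have h2 : v s - M.γ * ∑ a, π s a * ∑ s', M.P s a s' * v s' = 0 := h0
      nlinarith [M.γ_pos]) s
    simpa using this
  have hinj : Function.Injective T := by
    rw [← LinearMap.ker_eq_bot, LinearMap.ker_eq_bot']
    intro v hv
    funext s
    refine le_antisymm (hle v hv s) ?_
    have := hle (-v) (by rw [map_neg, hv, neg_zero]) s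
    simpa using this
  obtain ⟨v, hv⟩ := LinearMap.injective_iff_surjective.1 hinj fun s => ∑ a, π s a * c s a
  refine ⟨v, fun s => ?_⟩
  have h2 : v s - M.γ * ∑ a, π s a * ∑ s', M.P s a s' * v s' = ∑ a, π s a * c s a := congrFun hv s
  simp only [mul_add, Finset.sum_add_distrib, mul_left_comm _ M.γ, ← Finset.mul_sum]
  linarith

theorem discountedReturn_single_bellman [DecidableEq S] (hπ : ∀ s, π s ∈ stdSimplex ℝ A)
    (c : S → A → ℝ) (s : S) :
    M.discountedReturn π (Pi.single s 1) c = ∑ a, π s a * (c s a + M.γ * ∑ s', M.P s a s' *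
      M.discountedReturn π (Pi.single s' 1) c) := by
  obtain ⟨v, hv⟩ := M.exists_bellman hπ c
  have : ∀ s, M.discountedReturn π (Pi.single s 1) c = v s := fun s => by
    rw [M.discountedReturn_eq_sum hπ (single_mem_stdSimplex ℝ s) hv]
    simp [Pi.single_apply]
  simp only [this]
  exact hv s

theorem discountedReturn_eq_sum_single [DecidableEq S] (hπ : ∀ s, π s ∈ stdSimplex ℝ A)
    (hν : ν ∈ stdSimplex ℝ S) (c : S → A → ℝ) :
    M.discountedReturn π ν c = ∑ s, ν s * M.discountedReturn π (Pi.single s 1) c :=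
  M.discountedReturn_eq_sum hπ hν (M.discountedReturn_single_bellman hπ c)

theorem discountedReturn_add_mul (hπ : ∀ s, π s ∈ stdSimplex ℝ A) (hν : ν ∈ stdSimplex ℝ S)
    (c d : S → A → ℝ) (x : ℝ) :
    M.discountedReturn π ν (fun s a => c s a + x * d s a)
      = M.discountedReturn π ν c + x * M.discountedReturn π ν d := by
  simp only [discountedReturn]
  rw [← tsum_mul_left, ← (M.summable_discounted hπ hν _).tsum_add
    ((M.summable_discounted hπ hν _).mul_left x)]
  refine tsum_congr fun t => ?_
  simp only [mul_add, Finset.sum_add_distrib, mul_left_comm _ x, ← Finset.mul_sum]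

theorem discountedReturn_sum_mul (hπ : ∀ s, π s ∈ stdSimplex ℝ A) (hν : ν ∈ stdSimplex ℝ S)
    {κ : Type*} (I : Finset κ) (w : κ → ℝ) (c : κ → S → A → ℝ) :
    M.discountedReturn π ν (fun s a => ∑ k ∈ I, w k * c k s a)
      = ∑ k ∈ I, w k * M.discountedReturn π ν (c k) := by
  classical
  induction I using Finset.induction_on with
  | empty => simp [discountedReturn]
  | insert k I hk ih =>
    simp only [Finset.sum_insert hk]
    rw [← ih, add_comm, ← M.discountedReturn_add_mul hπ hν]
    simp only [add_comm]

section Soft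

variable [DecidableEq S] (τ : ℝ) (w : Fin K → ℝ)

theorem softStateValue_eq (hπ : ∀ s, π s ∈ stdSimplex ℝ A) (s : S) :
    M.softStateValue τ w π s = ∑ a, π s a * (M.softQ τ w π s a - τ * Real.log (π s a)) := by
  rw [softStateValue, M.discountedReturn_single_bellman hπ]
  refine Finset.sum_congr rfl fun a _ => ?_
  simp only [softQ, softStateValue]
  ring

theorem tsum_discounted_eq_visitation (hπ : ∀ s, π s ∈ stdSimplex ℝ A) (f : S → ℝ) :
    ∑' t : ℕ, M.γ ^ t * ∑ s, M.stateLaw π M.μ t s * f s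
      = (∑ s, M.visitation π s * f s) / (1 - M.γ) := by
  have hs : ∀ s, Summable fun t : ℕ => M.γ ^ t * M.stateLaw π M.μ t s := fun s => by
    simpa [Pi.single_apply] using M.summable_discounted hπ M.μ_mem (Pi.single s 1)
  have h1 : ∀ s, M.visitation π s * f s
      = (1 - M.γ) * ∑' t : ℕ, M.γ ^ t * M.stateLaw π M.μ t s * f s := fun s => by
    rw [visitation, tsum_mul_right, mul_assoc]
  rw [eq_div_iff M.one_sub_γ_pos.ne', Finset.sum_congr rfl fun s _ => h1 s, ← Finset.mul_sum,
    ← Summable.tsum_finsetSum fun s _ => (hs s).mul_right (f s), mul_comm]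
  simp only [Finset.mul_sum, mul_assoc]

/-- The performance difference identity with the soft value of `π` as baseline. It serves both the
policy gradient, by varying `ρ` around `π`, and the equilibrium condition. -/
theorem softQ_discountedReturn (hπ : ∀ s, π s ∈ stdSimplex ℝ A) {ρ : S → A → ℝ}
    (hρ : ∀ s, ρ s ∈ stdSimplex ℝ A) :
    M.discountedReturn ρ M.μ (fun s a => ∑ k, w k * M.r s a k - τ * Real.log (ρ s a))
      = M.discountedReturn π M.μ (fun s a => ∑ k, w k * M.r s a k - τ * Real.log (π s a))
        + (∑ s, M.visitation ρ s * (∑ a, ρ s a * (M.softQ τ w π s a - τ * Real.log (ρ s a))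
          - M.softStateValue τ w π s)) / (1 - M.γ) := by
  rw [M.discountedReturn_eq_add hρ M.μ_mem _ (M.softStateValue τ w π),
    ← M.tsum_discounted_eq_visitation hρ, M.discountedReturn_eq_sum_single hπ M.μ_mem]
  congr 1
  simp only [softQ]
  refine tsum_congr fun t => ?_
  congr 1
  refine Finset.sum_congr rfl fun s _ => ?_
  congr 2
  refine Finset.sum_congr rfl fun a _ => ?_
  ring

end Soft

/-- Induction along a path of positive probability: a full-support policy takes each of its actions
with positive probability. -/
theorem exists_stateLaw_pos (hreach : M.AllReachable) (hπ : ∀ s, π s ∈ stdSimplex ℝ A)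
    (hpos : ∀ s a, 0 < π s a) (s : S) : ∃ t, 0 < M.stateLaw π M.μ t s := by
  obtain ⟨s₀, h0, hr⟩ := hreach s
  induction hr with
  | refl => exact ⟨0, h0⟩
  | tail _ hstep ih =>
    rename_i b c _
    obtain ⟨t, ht⟩ := ih
    obtain ⟨a, ha⟩ := hstep
    have hnn : ∀ x a', 0 ≤ π x a' * M.P x a' c := fun x a' =>
      mul_nonneg (hpos x a').le ((M.P_mem x a').1 c)
    refine ⟨t + 1, Finset.sum_pos' (fun x _ => mul_nonneg
      ((M.stateLaw_mem_stdSimplex hπ M.μ_mem t).1 x) (Finset.sum_nonneg fun a' _ => hnn x a'))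
      ⟨b, Finset.mem_univ b, mul_pos ht ?_⟩⟩
    exact Finset.sum_pos' (fun a' _ => hnn b a') ⟨a, Finset.mem_univ a, mul_pos (hpos b a) ha⟩

theorem visitation_pos [DecidableEq S] (hreach : M.AllReachable)
    (hπ : ∀ s, π s ∈ stdSimplex ℝ A) (hpos : ∀ s a, 0 < π s a) (s : S) :
    0 < M.visitation π s := by
  have hs : Summable fun t : ℕ => M.γ ^ t * M.stateLaw π M.μ t s := by
    simpa [Pi.single_apply] using M.summable_discounted hπ M.μ_mem (Pi.single s 1)
  obtain ⟨t, ht⟩ := M.exists_stateLaw_pos hreach hπ hpos s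
  exact mul_pos M.one_sub_γ_pos (hs.tsum_pos (fun t => mul_nonneg (pow_pos M.γ_pos t).le
    ((M.stateLaw_mem_stdSimplex hπ M.μ_mem t).1 s)) t (mul_pos (pow_pos M.γ_pos t) ht))

end MOMDP

/-! ### Policy gradient, Fisher matrix and the natural gradient step. -/

/-- Where `h` vanishes the product rule needs only continuity of `d`. With `d` the visitation
measure, the policy gradient is obtained without differentiating that measure. -/
theorem HasFDerivAt.mul_of_apply_eq_zero {E : Type*} [NormedAddCommGroup E] [NormedSpace ℝ E]
    {d h : E → ℝ} {h' : E →L[ℝ] ℝ} {x : E} (hd : ContinuousAt d x) (hh : HasFDerivAt h h' x)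
    (h0 : h x = 0) : HasFDerivAt (fun y => d y * h y) (d x • h') x := by
  rw [hasFDerivAt_iff_isLittleO] at hh ⊢
  have h1 : (fun y => d y * (h y - h x - h' (y - x))) =o[nhds x] fun y => y - x := by
    simpa using (hd.isBigO_one ℝ).mul_isLittleO hh.norm_right
  have h2 : (fun y => (d y - d x) * h' (y - x)) =o[nhds x] fun y => y - x := by
    have h3 : (fun y => d y - d x) =o[nhds x] fun _ => (1 : ℝ) := by
      rw [Asymptotics.isLittleO_one_iff]
      simpa using hd.sub_const (d x)
    simpa using h3.mul_isBigO (h'.isBigO_sub (nhds x) x).norm_right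
  refine (h1.add h2).congr_left fun y => ?_
  simp only [h0, _root_.smul_apply, smul_eq_mul]
  ring

theorem ContinuousLinearMap.apply_eq_sum_single {ι : Type*} [Fintype ι] [DecidableEq ι]
    (L : (ι → ℝ) →L[ℝ] ℝ) (x : ι → ℝ) : L x = ∑ j, L (Pi.single j 1) * x j := by
  conv_lhs => rw [← Finset.univ_sum_single x, map_sum]
  refine Finset.sum_congr rfl fun j _ => ?_
  rw [mul_comm, ← smul_eq_mul, ← map_smul, ← Pi.single_smul, smul_eq_mul, mul_one]

section Score

variable {S A : Type*} [Fintype A]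

/-- The derivative at `θ` of the log-likelihood `log π_θ(a|s)` of a softmax policy. -/
def policyScore (θ : S × A → ℝ) (s : S) (a : A) : (S × A → ℝ) →L[ℝ] ℝ :=
  ContinuousLinearMap.proj (s, a)
    - ∑ a', softmaxPolicy θ s a' • ContinuousLinearMap.proj (R := ℝ) (φ := fun _ => ℝ) (s, a')

theorem policyScore_apply (θ x : S × A → ℝ) (s : S) (a : A) :
    policyScore θ s a x = x (s, a) - ∑ a', softmaxPolicy θ s a' * x (s, a') := by
  simp [policyScore]

variable [Nonempty A]

theorem sum_softmaxPolicy_smul_policyScore (θ : S × A → ℝ) (s : S) :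
    ∑ a, softmaxPolicy θ s a • policyScore θ s a = 0 := by
  ext x
  simp only [_root_.sum_apply, _root_.smul_apply, smul_eq_mul,
    policyScore_apply, mul_sub, Finset.sum_sub_distrib, ← Finset.sum_mul,
    (softmaxPolicy_mem_stdSimplex θ s).2, one_mul, sub_self, _root_.zero_apply]

variable [Fintype S]

theorem hasFDerivAt_log_softmaxPolicy (θ : S × A → ℝ) (s : S) (a : A) :
    HasFDerivAt (fun θ' => Real.log (softmaxPolicy θ' s a)) (policyScore θ s a) θ := by
  simp only [softmaxPolicy, log_softmax]
  have h := (HasFDerivAt.fun_sum (u := Finset.univ) fun (a' : A) _ =>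
    (hasFDerivAt_apply (𝕜 := ℝ) (F' := fun _ : S × A => ℝ) (s, a') θ).exp).log
      (sum_exp_pos fun a' => θ (s, a')).ne'
  refine ((hasFDerivAt_apply (𝕜 := ℝ) (F' := fun _ : S × A => ℝ) (s, a) θ).sub h).congr_fderiv ?_
  rw [policyScore, Finset.smul_sum]
  congr 1
  refine Finset.sum_congr rfl fun a' _ => ?_
  rw [smul_smul, softmaxPolicy, softmax, div_eq_inv_mul]

theorem hasFDerivAt_softmaxPolicy (θ : S × A → ℝ) (s : S) (a : A) :
    HasFDerivAt (fun θ' => softmaxPolicy θ' s a) (softmaxPolicy θ s a • policyScore θ s a) θ := by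
  have h := (hasFDerivAt_log_softmaxPolicy θ s a).exp
  simp only [Real.exp_log (softmaxPolicy_pos _ s a)] at h
  exact h

theorem continuous_softmaxPolicy (s : S) (a : A) :
    Continuous fun θ : S × A → ℝ => softmaxPolicy θ s a :=
  continuous_iff_continuousAt.2 fun θ => (hasFDerivAt_softmaxPolicy θ s a).continuousAt

theorem hasFDerivAt_sum_softmaxPolicy_mul (τ : ℝ) (q : A → ℝ) (v : ℝ) (θ : S × A → ℝ) (s : S) :
    HasFDerivAt
      (fun θ' => ∑ a, softmaxPolicy θ' s a * (q a - τ * Real.log (softmaxPolicy θ' s a)) - v)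
      (∑ a, (softmaxPolicy θ s a * (q a - τ * Real.log (softmaxPolicy θ s a) - v)) •
        policyScore θ s a) θ := by
  have h := (HasFDerivAt.fun_sum (u := Finset.univ) fun a _ =>
    (hasFDerivAt_softmaxPolicy θ s a).mul
      (((hasFDerivAt_log_softmaxPolicy θ s a).const_mul τ).const_sub (q a))).sub_const v
  refine h.congr_fderiv ?_
  -- The score has mean zero under the policy, so a constant can be added to its coefficient. The
  -- multiple `v - τ` removes the `-τ` produced by differentiating the logarithm and inserts the
  -- baseline `v`.
  have h0 := congrArg (fun L => (v - τ) • L) (sum_softmaxPolicy_smul_policyScore θ s)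
  simp only [smul_zero, Finset.smul_sum] at h0
  rw [← add_zero (∑ a, (softmaxPolicy θ s a * _) • policyScore θ s a), ← h0,
    ← Finset.sum_add_distrib]
  refine Finset.sum_congr rfl fun a _ => ?_
  ext x
  simp only [_root_.add_apply, _root_.smul_apply, smul_eq_mul,
    _root_.neg_apply]
  ring

variable [DecidableEq S] [DecidableEq A]

theorem coordGrad_log_softmaxPolicy (θ : S × A → ℝ) (s : S) (a : A) (i : S × A) :
    coordGrad (fun θ' => Real.log (softmaxPolicy θ' s a)) θ i
      = policyScore θ s a (Pi.single i 1) := by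
  rw [coordGrad, (hasFDerivAt_log_softmaxPolicy θ s a).fderiv]

end Score

namespace MOMDP

variable {S A : Type*} [Fintype S] [Fintype A] {K : ℕ} (M : MOMDP S A K)

theorem softValue_eq (τ : ℝ) (π : S → A → ℝ) (k : Fin K) :
    M.softValue τ π k = M.discountedReturn π M.μ
      (fun s a => ∑ j, (Pi.single k 1 : Fin K → ℝ) j * M.r s a j - τ * Real.log (π s a)) := by
  simp [softValue, Pi.single_apply]

theorem sum_mul_softValue {τ : ℝ} {w : Fin K → ℝ} (hw : ∑ k, w k = 1) {π : S → A → ℝ}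
    (hπ : ∀ s, π s ∈ stdSimplex ℝ A) :
    ∑ k, w k * M.softValue τ π k = M.discountedReturn π M.μ
      (fun s a => ∑ k, w k * M.r s a k - τ * Real.log (π s a)) := by
  simp only [softValue]
  rw [← M.discountedReturn_sum_mul hπ M.μ_mem]
  simp only [mul_sub, Finset.sum_sub_distrib, ← Finset.sum_mul, hw, one_mul]

variable [Nonempty A]

theorem continuous_visitation (s : S) :
    Continuous fun θ : S × A → ℝ => M.visitation (softmaxPolicy θ) s := by
  refine continuous_const.mul (continuous_tsum (u := fun t => M.γ ^ t) (fun t => ?_)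
    (summable_geometric_of_lt_one M.γ_pos.le M.γ_lt_one) fun t θ => ?_)
  · refine continuous_const.mul ?_
    induction t generalizing s with
    | zero => exact continuous_const
    | succ t ih =>
      exact continuous_finsetSum _ fun s' _ => (ih s').mul
        (continuous_finsetSum _ fun a _ => (continuous_softmaxPolicy s' a).mul continuous_const)
  · have h := M.stateLaw_mem_stdSimplex (softmaxPolicy_mem_stdSimplex θ) M.μ_mem t
    rw [Real.norm_eq_abs, abs_mul, abs_of_pos (pow_pos M.γ_pos t), abs_of_nonneg (h.1 s)]
    exact mul_le_of_le_one_right (pow_pos M.γ_pos t).le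
      (h.2 ▸ Finset.single_le_sum (fun x _ => h.1 x) (Finset.mem_univ s))

variable [DecidableEq S]

/-- The soft advantage function of a policy. -/
def softAdvantage (τ : ℝ) (w : Fin K → ℝ) (π : S → A → ℝ) (i : S × A) : ℝ :=
  M.softQ τ w π i.1 i.2 - τ * Real.log (π i.1 i.2) - M.softStateValue τ w π i.1

/-- Policy gradient theorem for the entropy-regularized return. -/
theorem hasFDerivAt_discountedReturn (τ : ℝ) (w : Fin K → ℝ) (θ : S × A → ℝ) :
    HasFDerivAt (fun θ' => M.discountedReturn (softmaxPolicy θ') M.μ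
        (fun s a => ∑ k, w k * M.r s a k - τ * Real.log (softmaxPolicy θ' s a)))
      ((1 - M.γ)⁻¹ • ∑ s, M.visitation (softmaxPolicy θ) s • ∑ a, (softmaxPolicy θ s a *
        M.softAdvantage τ w (softmaxPolicy θ) (s, a)) • policyScore θ s a) θ := by
  rw [funext fun θ' => M.softQ_discountedReturn τ w (softmaxPolicy_mem_stdSimplex θ)
    (softmaxPolicy_mem_stdSimplex θ')]
  simp only [div_eq_inv_mul]
  refine ((HasFDerivAt.fun_sum fun s _ => HasFDerivAt.mul_of_apply_eq_zero
    (M.continuous_visitation s).continuousAt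
    (hasFDerivAt_sum_softmaxPolicy_mul τ (M.softQ τ w (softmaxPolicy θ) s) _ θ s) ?_).const_mul
      (1 - M.γ)⁻¹).const_add _
  rw [← M.softStateValue_eq τ w (softmaxPolicy_mem_stdSimplex θ), sub_self]

/-- The advantage has mean zero under the policy, so centring leaves it unchanged. Hence the policy
gradient is the Fisher matrix applied to the advantage, up to the factor `(1 - γ)⁻¹`. -/
theorem policyScore_softAdvantage (τ : ℝ) (w : Fin K → ℝ) (θ : S × A → ℝ) (s : S) (a : A) :
    policyScore θ s a (M.softAdvantage τ w (softmaxPolicy θ))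
      = M.softAdvantage τ w (softmaxPolicy θ) (s, a) := by
  rw [policyScore_apply, sub_eq_self]
  simp only [softAdvantage, mul_sub _ _ (M.softStateValue _ _ _ _), Finset.sum_sub_distrib,
    ← Finset.sum_mul, (softmaxPolicy_mem_stdSimplex θ s).2, one_mul]
  rw [M.softStateValue_eq τ w (softmaxPolicy_mem_stdSimplex θ), sub_self]

variable [DecidableEq A]

theorem sum_smul_coordGrad_softValue (τ : ℝ) {w : Fin K → ℝ} (hw : ∑ k, w k = 1)
    (θ : S × A → ℝ) (i : S × A) :
    (∑ k, w k • coordGrad (fun θ' => M.softValue τ (softmaxPolicy θ') k) θ) i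
      = (1 - M.γ)⁻¹ * ∑ s, M.visitation (softmaxPolicy θ) s * ∑ a, (softmaxPolicy θ s a *
        M.softAdvantage τ w (softmaxPolicy θ) (s, a)) * policyScore θ s a (Pi.single i 1) := by
  have hd : ∀ k, DifferentiableAt ℝ (fun θ' => M.softValue τ (softmaxPolicy θ') k) θ := fun k => by
    simp only [softValue_eq]
    exact (M.hasFDerivAt_discountedReturn τ _ θ).differentiableAt
  have h1 := HasFDerivAt.fun_sum (u := Finset.univ) fun k _ => (hd k).hasFDerivAt.const_mul (w k)
  simp only [M.sum_mul_softValue hw (softmaxPolicy_mem_stdSimplex _)] at h1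
  have h2 := congrArg (fun L => L (Pi.single i 1)) (h1.unique (M.hasFDerivAt_discountedReturn τ w θ))
  simpa [coordGrad, Finset.sum_apply] using h2

theorem fisher_mulVec (θ x : S × A → ℝ) (i : S × A) :
    (M.fisher θ).mulVec x i = ∑ s, M.visitation (softmaxPolicy θ) s * ∑ a,
      (softmaxPolicy θ s a * policyScore θ s a x) * policyScore θ s a (Pi.single i 1) := by
  simp only [fisher, Matrix.mulVec, dotProduct, Matrix.sum_apply, Matrix.smul_apply,
    Matrix.vecMulVec_apply, coordGrad_log_softmaxPolicy, smul_eq_mul, Finset.sum_mul]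
  rw [Finset.sum_comm]
  refine Finset.sum_congr rfl fun s _ => ?_
  rw [Finset.sum_comm, Finset.mul_sum]
  refine Finset.sum_congr rfl fun a _ => ?_
  rw [(policyScore θ s a).apply_eq_sum_single x, Finset.mul_sum, Finset.sum_mul, Finset.mul_sum]
  exact Finset.sum_congr rfl fun j _ => by ring

/-- The Fisher quadratic form is a sum of squared scores with strictly positive weights, so on the
kernel each score vanishes and `x (s, a)` equals its policy average over actions. -/
theorem exists_eq_of_fisher_mulVec_eq_zero (hreach : M.AllReachable) {θ x : S × A → ℝ}
    (h : (M.fisher θ).mulVec x = 0) : ∃ c : S → ℝ, ∀ s a, x (s, a) = c s := by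
  refine ⟨fun s => ∑ a', softmaxPolicy θ s a' * x (s, a'), fun s a => ?_⟩
  have hπ := softmaxPolicy_pos θ
  have hd := M.visitation_pos hreach (softmaxPolicy_mem_stdSimplex θ) hπ
  have h0 : ∑ s, M.visitation (softmaxPolicy θ) s * ∑ a,
      softmaxPolicy θ s a * policyScore θ s a x ^ 2 = 0 := by
    have h1 : ∑ i, (M.fisher θ).mulVec x i * x i = 0 := by simp [h]
    rw [← h1]
    simp only [fisher_mulVec, Finset.sum_mul]
    rw [Finset.sum_comm]
    refine Finset.sum_congr rfl fun s _ => ?_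
    simp only [mul_assoc, ← Finset.mul_sum, Finset.sum_mul]
    rw [Finset.sum_comm]
    congr 1
    refine Finset.sum_congr rfl fun a _ => ?_
    rw [← Finset.mul_sum, ← Finset.mul_sum, ← (policyScore θ s a).apply_eq_sum_single x, sq]
  have hnn : ∀ s a, 0 ≤ softmaxPolicy θ s a * policyScore θ s a x ^ 2 := fun s a =>
    mul_nonneg (hπ s a).le (sq_nonneg _)
  have h1 := (Finset.sum_eq_zero_iff_of_nonneg fun s _ => mul_nonneg (hd s).le
    (Finset.sum_nonneg fun a _ => hnn s a)).1 h0 s (Finset.mem_univ s)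
  have h2 := (Finset.sum_eq_zero_iff_of_nonneg fun a _ => hnn s a).1
    ((mul_eq_zero.1 h1).resolve_left (hd s).ne') a (Finset.mem_univ a)
  have h3 := pow_eq_zero_iff (two_ne_zero) |>.1 ((mul_eq_zero.1 h2).resolve_left (hπ s a).ne')
  rwa [policyScore_apply, sub_eq_zero] at h3

/-- The natural gradient step moves the softmax parameter along the soft advantage, up to a shift
in each state. -/
theorem exists_npgStep_eq (hreach : M.AllReachable) (τ η : ℝ) (θ : S × A → ℝ) {w : Fin K → ℝ}
    (hw : ∑ k, w k = 1) : ∃ c : S → ℝ, ∀ s a, M.npgStep τ η θ w (s, a)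
      = θ (s, a) + η / (1 - M.γ) * M.softAdvantage τ w (softmaxPolicy θ) (s, a) + c s := by
  set F := M.fisher θ with hF
  set Adv := M.softAdvantage τ w (softmaxPolicy θ) with hAdv
  have hg : (∑ k, w k • coordGrad (fun θ' => M.softValue τ (softmaxPolicy θ') k) θ)
      = (1 - M.γ)⁻¹ • F.mulVec Adv := by
    funext i
    rw [M.sum_smul_coordGrad_softValue τ hw, Pi.smul_apply, hF, fisher_mulVec, smul_eq_mul]
    simp only [hAdv, policyScore_softAdvantage]
  -- `F F† F = F` puts `F† F Adv - Adv` in the kernel of `F`, so the pseudo-inverse recovers the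
  -- advantage up to a shift in each state.
  obtain ⟨c, hc⟩ := M.exists_eq_of_fisher_mulVec_eq_zero hreach (θ := θ)
    (x := (pinv F).mulVec (F.mulVec Adv) - Adv) (by
      rw [Matrix.mulVec_sub, Matrix.mulVec_mulVec, Matrix.mulVec_mulVec, ← hF,
        (pinv_spec F).mul_mul_self, sub_self])
  refine ⟨fun s => η / (1 - M.γ) * c s, fun s a => ?_⟩
  have h1 := hc s a
  rw [Pi.sub_apply, sub_eq_iff_eq_add] at h1
  rw [npgStep, hg, Matrix.mulVec_smul, Pi.add_apply, Pi.smul_apply, Pi.smul_apply, ← hF, h1,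
    smul_eq_mul, smul_eq_mul]
  ring

end MOMDP

/-! ### One-state entropy-regularized maximization. -/

section RegularizedMax

variable {ι : Type*} [Fintype ι] {τ : ℝ}

theorem sum_mul_sub_log_eq (hτ : 0 < τ) (p q : ι → ℝ) :
    ∑ a, p a * (q a - τ * Real.log (p a))
      = τ * (∑ a, p a * (q a / τ) + ∑ a, Real.negMulLog (p a)) := by
  rw [← Finset.sum_add_distrib, Finset.mul_sum]
  refine Finset.sum_congr rfl fun a _ => ?_
  rw [Real.negMulLog]
  field_simp
  ring

variable [Nonempty ι]

theorem sum_mul_sub_log_le (hτ : 0 < τ) {p : ι → ℝ} (hp : p ∈ stdSimplex ℝ ι) (q : ι → ℝ) :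
    ∑ a, p a * (q a - τ * Real.log (p a)) ≤ τ * Real.log (∑ a, Real.exp (q a / τ)) := by
  rw [sum_mul_sub_log_eq hτ]
  exact mul_le_mul_of_nonneg_left (sum_mul_add_negMulLog_le _ hp) hτ.le

theorem sum_softmax_mul_sub_log (hτ : 0 < τ) {p : ι → ℝ} (q : ι → ℝ)
    (hp : p = softmax fun a => q a / τ) :
    ∑ a, p a * (q a - τ * Real.log (p a)) = τ * Real.log (∑ a, Real.exp (q a / τ)) := by
  rw [sum_mul_sub_log_eq hτ, hp, sum_softmax_mul_add_negMulLog fun a => q a / τ]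

/-- Moving a regularized greedy choice towards `q` does not decrease the regularized value
of `q`. -/
theorem sum_mul_sub_log_le_of_interpolation (hτ : 0 < τ) {ε : ℝ} (hε : 0 < ε) (hε1 : ε < 1)
    (q z : ι → ℝ) {p p' : ι → ℝ} (hp : p = softmax fun a => z a / τ)
    (hp' : p' = softmax fun a => ((1 - ε) * z a + ε * q a) / τ) :
    ∑ a, p a * (q a - τ * Real.log (p a)) ≤ ∑ a, p' a * (q a - τ * Real.log (p' a)) := by
  have hps : p ∈ stdSimplex ℝ ι := hp ▸ softmax_mem_stdSimplex _
  have hps' : p' ∈ stdSimplex ℝ ι := hp' ▸ softmax_mem_stdSimplex _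
  have split : ∀ u : ι → ℝ, ∑ a, u a * ((1 - ε) * z a + ε * q a - τ * Real.log (u a))
      = (1 - ε) * ∑ a, u a * (z a - τ * Real.log (u a))
        + ε * ∑ a, u a * (q a - τ * Real.log (u a)) := by
    intro u
    rw [Finset.mul_sum, Finset.mul_sum, ← Finset.sum_add_distrib]
    exact Finset.sum_congr rfl fun a _ => by ring
  have h1 := sum_mul_sub_log_le hτ hps' z
  rw [← sum_softmax_mul_sub_log hτ z hp] at h1
  have h2 := sum_mul_sub_log_le hτ hps fun a => (1 - ε) * z a + ε * q a
  rw [← sum_softmax_mul_sub_log hτ _ hp', split, split] at h2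
  -- `p'` is optimal for the mixture and `p` for `z`. Adding the two comparisons cancels the `z`
  -- parts and leaves `ε` times the claim.
  nlinarith [mul_le_mul_of_nonneg_left h1 (sub_nonneg.2 hε1.le)]

end RegularizedMax

/-! ### Stability of values and soft action values. -/

namespace MOMDP

variable {S A : Type*} [Fintype S] [Fintype A] {K : ℕ} (M : MOMDP S A K)

theorem abs_r_le_rMax (s : S) (a : A) (k : Fin K) : |M.r s a k| ≤ M.rMax :=
  le_ciSup (f := fun x : S × A × Fin K => |M.r x.1 x.2.1 x.2.2|) (Set.finite_range _).bddAbove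
    (s, a, k)

theorem abs_sum_mul_r_sub_le {R e : ℝ} (hR : ∀ s a k, |M.r s a k| ≤ R) (hR0 : 0 ≤ R)
    {w w' : Fin K → ℝ} (h : ∑ k, |w k - w' k| ≤ e) (s : S) (a : A) :
    |∑ k, w k * M.r s a k - ∑ k, w' k * M.r s a k| ≤ R * e := by
  rw [← Finset.sum_sub_distrib]
  simp only [← sub_mul]
  refine (abs_sum_mul_le_sum_abs_mul (hR s a)).trans ?_
  rw [mul_comm]
  exact mul_le_mul_of_nonneg_left h hR0

section Stability

variable {π π' : S → A → ℝ}

theorem discountedReturn_single_le [DecidableEq S] (hπ : ∀ s, π s ∈ stdSimplex ℝ A)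
    {c : S → A → ℝ} {B : ℝ} (hc : ∀ s a, c s a ≤ B) (s : S) :
    M.discountedReturn π (Pi.single s 1) c ≤ B / (1 - M.γ) := by
  refine le_div_one_sub_of_forall_bound (f := fun s => M.discountedReturn π (Pi.single s 1) c)
    M.γ_lt_one (fun U hU s => ?_) s
  rw [M.discountedReturn_single_bellman hπ]
  exact sum_mul_le_of_mem_stdSimplex (hπ s) fun a => add_le_add (hc s a)
    (mul_le_mul_of_nonneg_left (sum_mul_le_of_mem_stdSimplex (M.P_mem s a) hU) M.γ_pos.le)

theorem abs_discountedReturn_single_le [DecidableEq S] (hπ : ∀ s, π s ∈ stdSimplex ℝ A)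
    {c : S → A → ℝ} {B : ℝ} (hc : ∀ s a, |c s a| ≤ B) (s : S) :
    |M.discountedReturn π (Pi.single s 1) c| ≤ B / (1 - M.γ) := by
  refine abs_le.2 ⟨?_, M.discountedReturn_single_le hπ (fun s a => (abs_le.1 (hc s a)).2) s⟩
  have h := M.discountedReturn_single_le hπ (c := fun s a => 0 + (-1) * c s a) (B := B)
    (fun s a => by linarith [(abs_le.1 (hc s a)).1]) s
  rw [M.discountedReturn_add_mul hπ (single_mem_stdSimplex ℝ s) (fun _ _ => 0) c (-1)] at h
  have h0 : M.discountedReturn π (Pi.single s 1) (fun _ _ => 0) = 0 := by simp [discountedReturn]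
  linarith

theorem discountedReturn_sub_le (hπ : ∀ s, π s ∈ stdSimplex ℝ A)
    (hπ' : ∀ s, π' s ∈ stdSimplex ℝ A) {c : S → A → ℝ} {B e : ℝ} (hc : ∀ s a, |c s a| ≤ B)
    (hB : 0 ≤ B) (h : ∀ s, ∑ a, |π s a - π' s a| ≤ e) :
    M.discountedReturn π M.μ c - M.discountedReturn π' M.μ c ≤ e * (B / (1 - M.γ)) / (1 - M.γ) := by
  classical
  have hg := M.one_sub_γ_pos
  rw [M.discountedReturn_eq_sum_single hπ M.μ_mem, M.discountedReturn_eq_sum_single hπ' M.μ_mem,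
    ← Finset.sum_sub_distrib]
  simp only [← mul_sub]
  refine sum_mul_le_of_mem_stdSimplex M.μ_mem fun s => ?_
  refine le_div_one_sub_of_forall_bound (f := fun s => M.discountedReturn π (Pi.single s 1) c
    - M.discountedReturn π' (Pi.single s 1) c) M.γ_lt_one (fun U hU s => ?_) s
  rw [M.discountedReturn_single_bellman hπ, M.discountedReturn_single_bellman hπ' c s]
  set v := fun s => M.discountedReturn π (Pi.single s 1) c
  set v' := fun s => M.discountedReturn π' (Pi.single s 1) c
  have hv' : ∀ s, |v' s| ≤ B / (1 - M.γ) := M.abs_discountedReturn_single_le hπ' hc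
  have hq' : ∀ a, |c s a + M.γ * ∑ s', M.P s a s' * v' s'| ≤ B / (1 - M.γ) := fun a => by
    refine (abs_add_le _ _).trans ?_
    rw [abs_mul, abs_of_pos M.γ_pos]
    have h1 := mul_le_mul_of_nonneg_left
      (abs_sum_mul_le_of_mem_stdSimplex (M.P_mem s a) hv') M.γ_pos.le
    have h2 : B / (1 - M.γ) = B + M.γ * (B / (1 - M.γ)) := by field_simp; ring
    linarith [hc s a]
  have key : ∑ a, π s a * (c s a + M.γ * ∑ s', M.P s a s' * v s')
      - ∑ a, π' s a * (c s a + M.γ * ∑ s', M.P s a s' * v' s')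
      = ∑ a, (π s a - π' s a) * (c s a + M.γ * ∑ s', M.P s a s' * v' s')
        + M.γ * ∑ a, π s a * ∑ s', M.P s a s' * (v s' - v' s') := by
    rw [Finset.mul_sum, ← Finset.sum_sub_distrib, ← Finset.sum_add_distrib]
    refine Finset.sum_congr rfl fun a _ => ?_
    simp only [mul_sub, Finset.sum_sub_distrib]
    ring
  rw [key]
  refine add_le_add ?_ (mul_le_mul_of_nonneg_left (sum_mul_le_of_mem_stdSimplex (hπ s)
    fun a => sum_mul_le_of_mem_stdSimplex (M.P_mem s a) hU) M.γ_pos.le)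
  refine (le_abs_self _).trans ((abs_sum_mul_le_sum_abs_mul hq').trans ?_)
  exact mul_le_mul_of_nonneg_right (h s) (div_nonneg hB hg.le)

theorem abs_value_sub_le (hπ : ∀ s, π s ∈ stdSimplex ℝ A) (hπ' : ∀ s, π' s ∈ stdSimplex ℝ A)
    {R e : ℝ} (hR : ∀ s a k, |M.r s a k| ≤ R) (hR0 : 0 ≤ R)
    (h : ∀ s, ∑ a, |π s a - π' s a| ≤ e) (k : Fin K) :
    |M.value π k - M.value π' k| ≤ e * (R / (1 - M.γ)) / (1 - M.γ) :=
  abs_sub_le_iff.2 ⟨M.discountedReturn_sub_le hπ hπ' (fun s a => hR s a k) hR0 h,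
    M.discountedReturn_sub_le hπ' hπ (fun s a => hR s a k) hR0 fun s => by
      simpa only [abs_sub_comm] using h s⟩

variable [DecidableEq S] {τ : ℝ} {w w' : Fin K → ℝ} {δ : ℝ}

theorem softQ_sub_le_add {B : ℝ}
    (hδ : ∀ s a, ∑ k, w k * M.r s a k - ∑ k, w' k * M.r s a k ≤ δ)
    (hB : ∀ s, M.softStateValue τ w π s - M.softStateValue τ w' π' s ≤ B) (s : S) (a : A) :
    M.softQ τ w π s a - M.softQ τ w' π' s a ≤ δ + M.γ * B := by
  have h := sum_mul_le_of_mem_stdSimplex (M.P_mem s a) hB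
  simp only [mul_sub, Finset.sum_sub_distrib] at h
  simp only [softQ]
  nlinarith [hδ s a, M.γ_pos]

theorem softQ_sub_le_div {ρ : S → A → ℝ} (hρ : ∀ s, ρ s ∈ stdSimplex ℝ A)
    (hδ : ∀ s a, ∑ k, w k * M.r s a k - ∑ k, w' k * M.r s a k ≤ δ)
    (h : ∀ s, M.softStateValue τ w π s - M.softStateValue τ w' π' s
      ≤ ∑ a, ρ s a * (M.softQ τ w π s a - M.softQ τ w' π' s a)) (s : S) (a : A) :
    M.softQ τ w π s a - M.softQ τ w' π' s a ≤ δ / (1 - M.γ) := by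
  have hg := M.one_sub_γ_pos
  have h1 := le_div_one_sub_of_forall_bound (e := δ)
    (f := fun s => M.softStateValue τ w π s - M.softStateValue τ w' π' s) M.γ_lt_one
    fun B hB s => (h s).trans (sum_mul_le_of_mem_stdSimplex (hρ s) (M.softQ_sub_le_add hδ hB s))
  refine (M.softQ_sub_le_add hδ h1 s a).trans (le_of_eq ?_)
  field_simp
  ring

variable [Nonempty A]

/-- A policy that is greedy for its own soft action value is optimal for its weight, so another
policy can exceed it only through the change of reward. -/
theorem softQ_le_of_greedy (hτ : 0 < τ) (hπ : ∀ s, π s ∈ stdSimplex ℝ A)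
    (hπ' : ∀ s, π' s = softmax fun a => M.softQ τ w' π' s a / τ)
    (hδ : ∀ s a, ∑ k, w k * M.r s a k - ∑ k, w' k * M.r s a k ≤ δ) (s : S) (a : A) :
    M.softQ τ w π s a - M.softQ τ w' π' s a ≤ δ / (1 - M.γ) := by
  refine M.softQ_sub_le_div hπ hδ (fun s => ?_) s a
  rw [M.softStateValue_eq τ w hπ, M.softStateValue_eq τ w' fun s => hπ' s ▸
    softmax_mem_stdSimplex _, sum_softmax_mul_sub_log hτ _ (hπ' s)]
  refine (sub_le_sub_left (sum_mul_sub_log_le hτ (hπ s) (M.softQ τ w' π' s)) _).trans (le_of_eq ?_)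
  rw [← Finset.sum_sub_distrib]
  exact Finset.sum_congr rfl fun a _ => by ring

/-- Soft policy improvement: with the weight fixed, a step towards `Q` cannot decrease `Q`. A change
of weight costs at most its effect on the reward, summed over the discounted horizon. -/
theorem softQ_sub_le_of_interpolation (hτ : 0 < τ) {ε : ℝ} (hε : 0 < ε) (hε1 : ε < 1)
    {z : S → A → ℝ} (hπ : ∀ s, π s = softmax fun a => z s a / τ)
    (hπ' : ∀ s, π' s = softmax fun a => ((1 - ε) * z s a + ε * M.softQ τ w π s a) / τ)
    (hδ : ∀ s a, ∑ k, w k * M.r s a k - ∑ k, w' k * M.r s a k ≤ δ) (s : S) (a : A) :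
    M.softQ τ w π s a - M.softQ τ w' π' s a ≤ δ / (1 - M.γ) := by
  have hs' : ∀ s, π' s ∈ stdSimplex ℝ A := fun s => hπ' s ▸ softmax_mem_stdSimplex _
  refine M.softQ_sub_le_div hs' hδ (fun s => ?_) s a
  rw [M.softStateValue_eq τ w fun s => hπ s ▸ softmax_mem_stdSimplex _,
    M.softStateValue_eq τ w' hs']
  refine (sub_le_sub_right (sum_mul_sub_log_le_of_interpolation hτ hε hε1 _ _ (hπ s) (hπ' s))
    _).trans (le_of_eq ?_)
  rw [← Finset.sum_sub_distrib]
  exact Finset.sum_congr rfl fun a _ => by ring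

/-- The optimal soft value is a log-sum-exp of `Q`. Replacing that `Q` by `z` costs `Y`; the
log-sum-exp of `z` is attained at `π`, and passing from `z` to the action value of `π` costs `m`.
Only a one-sided bound on `z - Q` is needed. -/
theorem softQ_greedy_sub_le (hτ : 0 < τ) {z : S → A → ℝ} {Y m : ℝ}
    (hπ : ∀ s, π s = softmax fun a => z s a / τ)
    (hπ' : ∀ s, π' s = softmax fun a => M.softQ τ w' π' s a / τ)
    (hY : ∀ s a, M.softQ τ w' π' s a - z s a ≤ Y)
    (hm : ∀ s a, z s a - M.softQ τ w π s a ≤ m)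
    (hδ : ∀ s a, ∑ k, w' k * M.r s a k - ∑ k, w k * M.r s a k ≤ δ) (s : S) (a : A) :
    M.softQ τ w' π' s a - M.softQ τ w π s a ≤ δ + M.γ * (Y + m) := by
  have hs : ∀ s, π s ∈ stdSimplex ℝ A := fun s => hπ s ▸ softmax_mem_stdSimplex _
  refine M.softQ_sub_le_add hδ (fun s => ?_) s a
  rw [M.softStateValue_eq τ w hs, M.softStateValue_eq τ w' fun s => hπ' s ▸
    softmax_mem_stdSimplex _, sum_softmax_mul_sub_log hτ _ (hπ' s)]
  have h1 := sum_mul_le_of_mem_stdSimplex (hs s) (hm s)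
  have h2 := log_sum_exp_le (x := fun a => M.softQ τ w' π' s a / τ) (y := fun a => z s a / τ)
    (e := Y / τ) fun a => by
      rw [← add_div]
      exact div_le_div_of_nonneg_right (by linarith [hY s a]) hτ.le
  have h3 := mul_le_mul_of_nonneg_left h2 hτ.le
  rw [mul_add, mul_div_cancel₀ _ hτ.ne', ← sum_softmax_mul_sub_log hτ _ (hπ s)] at h3
  have h4 : ∑ a, π s a * (z s a - τ * Real.log (π s a))
      - ∑ a, π s a * (M.softQ τ w π s a - τ * Real.log (π s a))
      = ∑ a, π s a * (z s a - M.softQ τ w π s a) := by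
    rw [← Finset.sum_sub_distrib]
    exact Finset.sum_congr rfl fun a _ => by ring
  linarith

end Stability

/-! ### Equilibrium strategies are Gibbs responses. -/

section Nash

variable {τ τw : ℝ} {θ : S × A → ℝ} {w : Fin K → ℝ}

theorem IsNash.weight_eq (h : M.IsNash τ τw θ w) (hτw : 0 < τw) :
    w = softmax fun k => -M.value (softmaxPolicy θ) k / τw := by
  have hK : Nonempty (Fin K) := by
    by_contra hK
    rw [not_nonempty_iff] at hK
    simpa using h.1.2
  refine eq_softmax_of_le _ h.1 ?_
  rw [← sum_softmax_mul_add_negMulLog fun k => -M.value (softmaxPolicy θ) k / τw]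
  have h1 := h.2.2 _ (softmax_mem_stdSimplex fun k => -M.value (softmaxPolicy θ) k / τw)
  have key : ∀ u : Fin K → ℝ, ∑ k, u k * (-M.value (softmaxPolicy θ) k / τw)
      = -(∑ k, u k * M.value (softmaxPolicy θ) k) / τw := fun u => by
    rw [← Finset.sum_neg_distrib, Finset.sum_div]
    exact Finset.sum_congr rfl fun k _ => by ring
  simp only [gameUtility, shannonEntropy] at h1
  rw [key, key, ← sub_nonneg]
  have h2 : 0 ≤ τw * (-(∑ k, w k * M.value (softmaxPolicy θ) k) / τw + ∑ k, Real.negMulLog (w k)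
      - (-(∑ k, softmax (fun k => -M.value (softmaxPolicy θ) k / τw) k *
        M.value (softmaxPolicy θ) k) / τw
      + ∑ k, Real.negMulLog (softmax (fun k => -M.value (softmaxPolicy θ) k / τw) k))) := by
    rw [mul_sub, mul_add, mul_add, mul_div_cancel₀ _ hτw.ne', mul_div_cancel₀ _ hτw.ne']
    linarith
  exact nonneg_of_mul_nonneg_right h2 hτw

variable [Nonempty A]

theorem gameUtility_eq (τ τw : ℝ) (θ : S × A → ℝ) (w : Fin K → ℝ) :
    M.gameUtility τ τw θ w = M.discountedReturn (softmaxPolicy θ) M.μ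
        (fun s a => ∑ k, w k * M.r s a k - τ * Real.log (softmaxPolicy θ s a))
      - τw * shannonEntropy w := by
  have hπ := softmaxPolicy_mem_stdSimplex θ
  simp only [gameUtility, value, policyEntropy]
  rw [← M.discountedReturn_sum_mul hπ M.μ_mem, ← M.discountedReturn_add_mul hπ M.μ_mem]
  simp only [mul_neg, sub_eq_add_neg]

variable [DecidableEq S]

/-- Deviating to the softmax of `Q / τ` would gain, by the performance difference, a sum of
nonnegative terms with positive visitation weights. Equilibrium makes each term zero, so every `π s`
attains the Gibbs maximum. -/
theorem IsNash.policy_eq (h : M.IsNash τ τw θ w) (hreach : M.AllReachable) (hτ : 0 < τ) (s : S) :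
    softmaxPolicy θ s = softmax fun a => M.softQ τ w (softmaxPolicy θ) s a / τ := by
  set π := softmaxPolicy θ with hπdef
  set θ' : S × A → ℝ := fun i => M.softQ τ w π i.1 i.2 / τ
  have hπ : ∀ s, π s ∈ stdSimplex ℝ A := softmaxPolicy_mem_stdSimplex θ
  have hπ' : ∀ s, softmaxPolicy θ' s ∈ stdSimplex ℝ A := softmaxPolicy_mem_stdSimplex θ'
  have hd := M.visitation_pos hreach hπ' (softmaxPolicy_pos θ')
  have hval : ∀ s, ∑ a, softmaxPolicy θ' s a *
      (M.softQ τ w π s a - τ * Real.log (softmaxPolicy θ' s a))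
      = τ * Real.log (∑ a, Real.exp (M.softQ τ w π s a / τ)) := fun s =>
    sum_softmax_mul_sub_log hτ (M.softQ τ w π s) rfl
  have hnn : ∀ s, 0 ≤ ∑ a, softmaxPolicy θ' s a *
      (M.softQ τ w π s a - τ * Real.log (softmaxPolicy θ' s a)) - M.softStateValue τ w π s := by
    intro s
    rw [hval s, M.softStateValue_eq τ w hπ, sub_nonneg]
    exact sum_mul_sub_log_le hτ (hπ s) _
  have h1 := h.2.1 θ'
  rw [gameUtility_eq, gameUtility_eq, M.softQ_discountedReturn τ w hπ hπ'] at h1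
  have h2 : (∑ s, M.visitation (softmaxPolicy θ') s * (∑ a, softmaxPolicy θ' s a *
      (M.softQ τ w π s a - τ * Real.log (softmaxPolicy θ' s a)) - M.softStateValue τ w π s))
      / (1 - M.γ) ≤ 0 := by linarith
  have h3 := (div_le_iff₀ M.one_sub_γ_pos).1 h2
  rw [zero_mul] at h3
  have hterm : ∀ s ∈ Finset.univ, 0 ≤ M.visitation (softmaxPolicy θ') s * (∑ a,
      softmaxPolicy θ' s a * (M.softQ τ w π s a - τ * Real.log (softmaxPolicy θ' s a))
        - M.softStateValue τ w π s) := fun s _ => mul_nonneg (hd s).le (hnn s)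
  have h4 := (Finset.sum_eq_zero_iff_of_nonneg hterm).1
    (le_antisymm h3 (Finset.sum_nonneg hterm)) s (Finset.mem_univ s)
  have h5 := (mul_eq_zero.1 h4).resolve_left (hd s).ne'
  rw [hval s, M.softStateValue_eq τ w hπ,
    sum_mul_sub_log_eq hτ (π s), sub_eq_zero] at h5
  exact eq_softmax_of_le _ (hπ s) (mul_left_cancel₀ hτ.ne' h5).le

end Nash

end MOMDP

/-! ### From geometric decay to an iteration count. -/

theorem exists_nat_forall_geometric_le {G g : ℝ} (hG : 1 ≤ G) (hg : 0 < g) (hg1 : g ≤ 1) :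
    ∃ C : ℝ, 0 < C ∧ ∀ ε : ℝ, 0 < ε → ε < 1 → ∀ δ : ℝ, 0 < δ → δ ≤ 1 / 2 →
      ∃ N : ℕ, (N : ℝ) ≤ C / ε ^ 2 * Real.log (1 / δ) ∧
        ∀ t : ℕ, N ≤ t → G * (1 - g * ε ^ 2 / 4) ^ t ≤ δ := by
  have hl2 : 0 < Real.log 2 := Real.log_pos one_lt_two
  have hlG : 0 ≤ Real.log G := Real.log_nonneg hG
  -- Since `log (1 / δ) ≥ log 2` and `ε ^ 2 ≤ 1`, both `log G` and the `+ 1` from rounding up are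
  -- absorbed as multiples of `log (1 / δ)`; these are the two terms with `Real.log 2`.
  refine ⟨4 / g * (Real.log G / Real.log 2 + 1) + 1 / Real.log 2, by positivity,
    fun ε hε hε1 δ hδ hδ2 => ?_⟩
  have hG0 : 0 < G := one_pos.trans_le hG
  have hε2 : ε ^ 2 ≤ 1 := pow_le_one₀ hε.le hε1.le
  have hlδ : Real.log 2 ≤ Real.log (1 / δ) :=
    Real.log_le_log two_pos ((le_div_iff₀ hδ).2 (by linarith))
  have hlδ0 : 0 < Real.log (1 / δ) := hl2.trans_le hlδ
  set x := 4 / (g * ε ^ 2) * (Real.log G + Real.log (1 / δ)) with hx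
  have hx0 : 0 ≤ x := by positivity
  refine ⟨⌈x⌉₊, ?_, fun t ht => ?_⟩
  · have h1 : Real.log G ≤ Real.log G / Real.log 2 * Real.log (1 / δ) := by
      rw [div_mul_eq_mul_div, le_div_iff₀ hl2]
      exact mul_le_mul_of_nonneg_left hlδ hlG
    have h2 : 1 ≤ 1 / Real.log 2 / ε ^ 2 * Real.log (1 / δ) := by
      rw [div_div, div_mul_eq_mul_div, one_mul, le_div_iff₀ (by positivity), one_mul]
      exact (mul_le_of_le_one_right hl2.le hε2).trans hlδ
    have h3 : x ≤ 4 / (g * ε ^ 2) * (Real.log G / Real.log 2 * Real.log (1 / δ)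
        + Real.log (1 / δ)) := mul_le_mul_of_nonneg_left (by linarith) (by positivity)
    have h4 := (Nat.ceil_lt_add_one hx0).le
    calc _ ≤ x + 1 := h4
      _ ≤ _ := add_le_add h3 h2
      _ = _ := by field_simp
  · have ht' : x ≤ t := (Nat.le_ceil x).trans (by exact_mod_cast ht)
    have h1 : (1 - g * ε ^ 2 / 4) ^ t ≤ Real.exp (-(g * ε ^ 2 / 4) * t) := by
      rw [mul_comm (-(g * ε ^ 2 / 4)) (t : ℝ), Real.exp_nat_mul]
      refine pow_le_pow_left₀ (by nlinarith) ?_ t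
      have := Real.add_one_le_exp (-(g * ε ^ 2 / 4))
      linarith
    have h2 : -(g * ε ^ 2 / 4) * t ≤ -(Real.log G + Real.log (1 / δ)) := by
      have : g * ε ^ 2 / 4 * x = Real.log G + Real.log (1 / δ) := by
        rw [hx]
        field_simp
      nlinarith [mul_le_mul_of_nonneg_left ht' (show 0 ≤ g * ε ^ 2 / 4 by positivity)]
    have h3 : Real.exp (-(Real.log G + Real.log (1 / δ))) = δ / G := by
      rw [Real.exp_neg, Real.exp_add, Real.exp_log hG0, Real.exp_log (by positivity)]
      field_simp
    calc G * (1 - g * ε ^ 2 / 4) ^ t ≤ G * (δ / G) := mul_le_mul_of_nonneg_left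
          (h1.trans ((Real.exp_le_exp.2 h2).trans h3.le)) hG0.le
      _ = δ := by field_simp

/-! ### The coupled iteration and its Lyapunov bounds. -/

namespace MOMDP

variable {S A : Type*} [Fintype S] [Fintype A] {K : ℕ} (M : MOMDP S A K)

theorem weightStep_softmax [Nonempty (Fin K)] {τw : ℝ} (hτw : 0 < τw) {ε lam : ℝ} (hε : 0 < ε) (hε1 : ε < 1)
    (hlam : lam = ε ^ 2 / (τw * (1 - ε ^ 2))) (θ : S × A → ℝ) (ζ : Fin K → ℝ) :
    M.weightStep τw lam θ (softmax ζ)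
      = softmax fun k => (1 - ε ^ 2) * ζ k + ε ^ 2 * (-M.value (softmaxPolicy θ) k / τw) := by
  have h1 : 1 - ε ^ 2 ≠ 0 := by nlinarith
  -- The step size `lam` is chosen so that `β = 1 - ε ^ 2`.
  have h2 : 1 / (lam * τw + 1) = 1 - ε ^ 2 := by
    have : lam * τw + 1 = 1 / (1 - ε ^ 2) := by rw [hlam]; field_simp; ring
    rw [this, one_div_one_div]
  rw [weightStep, h2]
  refine softmax_congr_add (-(1 - ε ^ 2) * Real.log (∑ k, Real.exp (ζ k))) fun k => ?_
  rw [log_softmax]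
  ring

variable [DecidableEq S]

/-- Distance at most `L`, in units of value, between a policy-weight pair given in logarithmic
coordinates `(z, ζ)` and the equilibrium `(πs, ws)`. The number `R` bounds the rewards. -/
structure LogClose (τ τw R : ℝ) (πs : S → A → ℝ) (ws : Fin K → ℝ) (L : ℝ) (π : S → A → ℝ)
    (w : Fin K → ℝ) (z : S → A → ℝ) (ζ : Fin K → ℝ) : Prop where
  policy_eq : ∀ s, π s = softmax fun a => z s a / τ
  weight_eq : w = softmax ζ
  policy_le : ∀ s a, |M.softQ τ ws πs s a - z s a| ≤ L
  weight_le : ∀ k, |-M.value πs k / τw - ζ k| ≤ L * (1 - M.γ) ^ 2 / (4 * R)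
  defect_le : ∀ s a, z s a - M.softQ τ w π s a ≤ L * (1 - M.γ) / 2

variable {M} {τ τw R L : ℝ} {π πs : S → A → ℝ} {w ws : Fin K → ℝ} {z : S → A → ℝ}
  {ζ : Fin K → ℝ}

namespace LogClose

theorem sum_abs_weight_sub_le [Nonempty (Fin K)] (h : M.LogClose τ τw R πs ws L π w z ζ)
    (hws : ws = softmax fun k => -M.value πs k / τw) :
    ∑ k, |ws k - w k| ≤ L * (1 - M.γ) ^ 2 / (4 * R) := by
  rw [h.weight_eq, hws]
  exact sum_abs_softmax_sub_le h.weight_le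

theorem div_le (h : M.LogClose τ τw R πs ws L π w z ζ) (hτ : 0 < τ) (s : S) (a : A) :
    |M.softQ τ ws πs s a / τ - z s a / τ| ≤ L / τ := by
  rw [← sub_div, abs_div, abs_of_pos hτ]
  exact div_le_div_of_nonneg_right (h.policy_le s a) hτ.le

variable [Nonempty A]

theorem sum_abs_policy_sub_le (h : M.LogClose τ τw R πs ws L π w z ζ) (hτ : 0 < τ)
    (hπs : ∀ s, πs s = softmax fun a => M.softQ τ ws πs s a / τ) (s : S) :
    ∑ a, |πs s a - π s a| ≤ L / τ := by
  rw [h.policy_eq, hπs]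
  exact sum_abs_softmax_sub_le (h.div_le hτ s)

theorem abs_log_policy_sub_le (h : M.LogClose τ τw R πs ws L π w z ζ) (hτ : 0 < τ)
    (hπs : ∀ s, πs s = softmax fun a => M.softQ τ ws πs s a / τ) (s : S) (a : A) :
    |Real.log (πs s a) - Real.log (π s a)| ≤ 2 * (L / τ) := by
  rw [h.policy_eq, hπs]
  exact abs_log_softmax_sub_le (h.div_le hτ s) a

theorem abs_softQ_sub_le [Nonempty (Fin K)] (h : M.LogClose τ τw R πs ws L π w z ζ) (hτ : 0 < τ)
    (hR : ∀ s a k, |M.r s a k| ≤ R) (hR0 : 0 < R) (hL : 0 ≤ L)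
    (hπs : ∀ s, πs s = softmax fun a => M.softQ τ ws πs s a / τ)
    (hws : ws = softmax fun k => -M.value πs k / τw) (s : S) (a : A) :
    |M.softQ τ ws πs s a - M.softQ τ w π s a| ≤ L * (1 - (1 - M.γ) / 4) := by
  have hg := M.one_sub_γ_pos
  have hγ := M.γ_pos
  have hr : ∀ s a, |∑ k, ws k * M.r s a k - ∑ k, w k * M.r s a k| ≤ L * (1 - M.γ) ^ 2 / 4 :=
    fun s a => by
      refine (M.abs_sum_mul_r_sub_le hR hR0.le (h.sum_abs_weight_sub_le hws) s a).trans (le_of_eq ?_)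
      field_simp
  have hπ : ∀ s, π s ∈ stdSimplex ℝ A := fun s => h.policy_eq s ▸ softmax_mem_stdSimplex _
  have h1 := M.softQ_greedy_sub_le hτ h.policy_eq hπs (fun s a => (abs_le.1 (h.policy_le s a)).2)
    h.defect_le (fun s a => (abs_le.1 (hr s a)).2) s a
  have h2 := M.softQ_le_of_greedy hτ (w := w) hπ hπs (δ := L * (1 - M.γ) ^ 2 / 4)
    (fun s a => by linarith [(abs_le.1 (hr s a)).1]) s a
  have h3 : L * (1 - M.γ) ^ 2 / 4 / (1 - M.γ) = L * (1 - M.γ) / 4 := by field_simp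
  rw [h3] at h2
  have h4 := mul_nonneg hL hg.le
  have h5 := mul_nonneg hL (sq_nonneg (1 - M.γ))
  -- With `g = 1 - γ`, the upper side is `g²/4 + γ (1 + g/2) = 1 - g/2 - g²/4` times `L`, and the
  -- lower side costs only `L g / 4`.
  exact abs_le.2 ⟨by nlinarith, by nlinarith⟩

/-- One step of the coupled iteration contracts the distance to the equilibrium. -/
theorem step [Nonempty (Fin K)] (h : M.LogClose τ τw R πs ws L π w z ζ) (hτ : 0 < τ)
    (hτw : 0 < τw) (hR : ∀ s a k, |M.r s a k| ≤ R) (hR0 : 0 < R)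
    (hR2 : R ^ 2 = τ * τw * (1 - M.γ) ^ 4 / 12) (hL : 0 ≤ L)
    (hπs : ∀ s, πs s = softmax fun a => M.softQ τ ws πs s a / τ)
    (hws : ws = softmax fun k => -M.value πs k / τw)
    {ε : ℝ} (hε : 0 < ε) (hε1 : ε < 1) {π' : S → A → ℝ} {w' : Fin K → ℝ}
    (hπ' : ∀ s, π' s = softmax fun a => ((1 - ε) * z s a + ε * M.softQ τ w π s a) / τ)
    (hw' : w' = softmax fun k => (1 - ε ^ 2) * ζ k + ε ^ 2 * (-M.value π k / τw)) :
    M.LogClose τ τw R πs ws (L * (1 - (1 - M.γ) * ε ^ 2 / 4)) π' w'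
      (fun s a => (1 - ε) * z s a + ε * M.softQ τ w π s a)
      (fun k => (1 - ε ^ 2) * ζ k + ε ^ 2 * (-M.value π k / τw)) := by
  set g := 1 - M.γ with hgdef
  have hg : 0 < g := M.one_sub_γ_pos
  have hg1 : g ≤ 1 := by linarith [M.γ_pos]
  have hεε : ε ^ 2 ≤ ε := by nlinarith
  have hε2 : 0 < ε ^ 2 := by positivity
  have hπ : ∀ s, π s ∈ stdSimplex ℝ A := fun s => h.policy_eq s ▸ softmax_mem_stdSimplex _
  have hπss : ∀ s, πs s ∈ stdSimplex ℝ A := fun s => hπs s ▸ softmax_mem_stdSimplex _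
  -- The value is Lipschitz in the policy with constant `R / g ^ 2`, and the policies are within `L
  -- / τ`. The normalization of `R ^ 2` turns this into a third of the weight tolerance, leaving
  -- room to contract.
  have hV : ∀ k, |-M.value πs k / τw - -M.value π k / τw| ≤ L * g ^ 2 / (12 * R) := fun k => by
    have h1 := M.abs_value_sub_le hπss hπ hR hR0.le (h.sum_abs_policy_sub_le hτ hπs) k
    rw [← sub_div, abs_div, abs_of_pos hτw, neg_sub_neg, abs_sub_comm, div_le_iff₀ hτw]
    refine h1.trans (le_of_eq ?_)
    have h2 : τ * τw * g ^ 4 = 12 * R ^ 2 := by rw [hR2]; ring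
    rw [← hgdef]
    field_simp
    linear_combination (-L) * h2
  have hLg : 0 ≤ L * g ^ 2 / (12 * R) := by positivity
  have hX : L * g ^ 2 / (4 * R) = 3 * (L * g ^ 2 / (12 * R)) := by field_simp; ring
  refine ⟨hπ', hw', fun s a => ?_, fun k => ?_, fun s a => ?_⟩
  · have h1 := h.abs_softQ_sub_le hτ hR hR0 hL hπs hws s a
    have h2 : M.softQ τ ws πs s a - ((1 - ε) * z s a + ε * M.softQ τ w π s a)
        = (1 - ε) * (M.softQ τ ws πs s a - z s a)
          + ε * (M.softQ τ ws πs s a - M.softQ τ w π s a) := by ring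
    rw [h2]
    refine (abs_add_le _ _).trans ?_
    rw [abs_mul, abs_mul, abs_of_pos hε, abs_of_pos (sub_pos.2 hε1)]
    have h3 := mul_le_mul_of_nonneg_left (h.policy_le s a) (sub_pos.2 hε1).le
    have h4 := mul_le_mul_of_nonneg_left h1 hε.le
    have h5 := mul_le_mul_of_nonneg_left hεε (mul_nonneg hL hg.le)
    rw [← hgdef] at h4
    nlinarith
  · have h2 : -M.value πs k / τw - ((1 - ε ^ 2) * ζ k + ε ^ 2 * (-M.value π k / τw))
        = (1 - ε ^ 2) * (-M.value πs k / τw - ζ k)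
          + ε ^ 2 * (-M.value πs k / τw - -M.value π k / τw) := by ring
    rw [h2]
    refine (abs_add_le _ _).trans ?_
    have hε3 : 0 ≤ 1 - ε ^ 2 := by linarith
    rw [abs_mul, abs_mul, abs_of_pos hε2, abs_of_nonneg hε3]
    have h3 := mul_le_mul_of_nonneg_left (h.weight_le k) hε3
    have h4 := mul_le_mul_of_nonneg_left (hV k) hε2.le
    have h5 : L * (1 - g * ε ^ 2 / 4) * g ^ 2 / (4 * R)
        = (1 - g * ε ^ 2 / 4) * (3 * (L * g ^ 2 / (12 * R))) := by rw [← hX]; ring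
    rw [h5]
    rw [← hgdef, hX] at h3
    have h6 := mul_le_mul_of_nonneg_left hg1 (mul_nonneg hε2.le hLg)
    nlinarith [mul_nonneg hε2.le hLg]
  · have h1 : ∑ k, |w k - w' k| ≤ ε ^ 2 * (4 * (L * g ^ 2 / (12 * R))) := by
      rw [h.weight_eq, hw']
      refine sum_abs_softmax_sub_le fun k => ?_
      have h2 : ζ k - ((1 - ε ^ 2) * ζ k + ε ^ 2 * (-M.value π k / τw))
          = ε ^ 2 * ((-M.value πs k / τw - -M.value π k / τw)
            - (-M.value πs k / τw - ζ k)) := by ring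
      rw [h2, abs_mul, abs_of_pos hε2]
      refine mul_le_mul_of_nonneg_left ((abs_sub _ _).trans ?_) hε2.le
      have h3 := h.weight_le k
      rw [← hgdef, hX] at h3
      linarith [hV k]
    have h2 := M.softQ_sub_le_of_interpolation hτ hε hε1 (w' := w') h.policy_eq hπ'
      (fun s a => (abs_le.1 (M.abs_sum_mul_r_sub_le hR hR0.le h1 s a)).2) s a
    have h3 : R * (ε ^ 2 * (4 * (L * g ^ 2 / (12 * R)))) / (1 - M.γ) = ε ^ 2 * (L * g / 3) := by
      rw [← hgdef]
      field_simp
      ring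
    rw [h3] at h2
    have h4 := mul_le_mul_of_nonneg_left (h.defect_le s a) (sub_pos.2 hε1).le
    rw [← hgdef] at h4
    have h5 := mul_le_mul_of_nonneg_left hεε (mul_nonneg hL hg.le)
    have h6 := mul_le_mul_of_nonneg_left hg1 (mul_nonneg hε2.le (mul_nonneg hL hg.le))
    have h7 := mul_nonneg hε2.le (mul_nonneg hL hg.le)
    change (1 - ε) * z s a + ε * M.softQ τ w π s a - M.softQ τ w' π' s a ≤ _
    -- The new defect is `(1 - ε) (z - Q) + (Q - Q')`, at most `(1 - ε) L g / 2 + ε ^ 2 L g / 3`;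
    -- since `ε ^ 2 ≤ ε` this is at most `(L g / 2) (1 - ε ^ 2 / 3)`.
    nlinarith

end LogClose

theorem exists_logClose (hτ : 0 < τ) (hR0 : 0 < R) (θ : S × A → ℝ) (hw : ∑ k, w k = 1)
    (hpos : ∀ k, 0 < w k) (πs : S → A → ℝ) (ws : Fin K → ℝ) :
    ∃ L, 0 ≤ L ∧ M.LogClose τ τw R πs ws L (softmaxPolicy θ) w (fun s a => τ * θ (s, a))
      fun k => Real.log (w k) := by
  have hg := M.one_sub_γ_pos
  obtain ⟨B₁, h1⟩ := (Set.finite_range fun x : S × A =>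
    |M.softQ τ ws πs x.1 x.2 - τ * θ x|).bddAbove
  obtain ⟨B₂, h2⟩ := (Set.finite_range fun k =>
    |-M.value πs k / τw - Real.log (w k)|).bddAbove
  obtain ⟨B₃, h3⟩ := (Set.finite_range fun x : S × A =>
    τ * θ x - M.softQ τ w (softmaxPolicy θ) x.1 x.2).bddAbove
  refine ⟨max (max 0 B₁) (max (B₂ * (4 * R) / (1 - M.γ) ^ 2) (B₃ * 2 / (1 - M.γ))), by simp,
    fun s => ?_, (softmax_log hw hpos).symm, fun s a => ?_, fun k => ?_, fun s a => ?_⟩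
  · simp only [mul_div_cancel_left₀ _ hτ.ne']
    rfl
  · exact (h1 ⟨(s, a), rfl⟩).trans (by simp)
  · refine (h2 ⟨k, rfl⟩).trans ?_
    rw [le_div_iff₀ (by positivity), ← div_le_iff₀ (by positivity)]
    simp
  · refine (h3 ⟨(s, a), rfl⟩).trans ?_
    rw [le_div_iff₀ two_pos, ← div_le_iff₀ hg]
    simp

variable [DecidableEq A] [Nonempty A]

/-- The choice of `η` makes the advantage coefficient `ε / τ`. The entropy term `-τ log π` in the
advantage then supplies the factor `1 - ε` on `z`, and all terms depending on the state alone cancel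
in the softmax. -/
theorem softmaxPolicy_npgStep (hreach : M.AllReachable) (hτ : 0 < τ) {η ε : ℝ}
    (hη : η = ε * (1 - M.γ) / τ) {θ : S × A → ℝ} (hw : ∑ k, w k = 1)
    (hz : ∀ s, softmaxPolicy θ s = softmax fun a => z s a / τ) (s : S) :
    softmaxPolicy (M.npgStep τ η θ w) s
      = softmax fun a => ((1 - ε) * z s a + ε * M.softQ τ w (softmaxPolicy θ) s a) / τ := by
  obtain ⟨c, hc⟩ := M.exists_npgStep_eq hreach τ η θ hw
  have hg := M.one_sub_γ_pos
  have hη' : η / (1 - M.γ) = ε / τ := by rw [hη]; field_simp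
  have h1 : ∀ a, Real.log (softmaxPolicy θ s a)
      = z s a / τ - Real.log (∑ a, Real.exp (z s a / τ)) := fun a => by
    rw [hz, log_softmax fun a => z s a / τ]
  have h2 : ∀ a, θ (s, a) = Real.log (softmaxPolicy θ s a)
      + Real.log (∑ a, Real.exp (θ (s, a))) := fun a => by
    rw [softmaxPolicy, log_softmax fun a => θ (s, a), sub_add_cancel]
  refine softmax_congr_add (Real.log (∑ a, Real.exp (θ (s, a)))
    - (1 - ε) * Real.log (∑ a, Real.exp (z s a / τ))
    - ε / τ * M.softStateValue τ w (softmaxPolicy θ) s + c s) fun a => ?_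
  rw [hc, hη', h2 a, softAdvantage, h1 a]
  field_simp
  ring

theorem exists_logClose_eram [Nonempty (Fin K)] (hreach : M.AllReachable) (hτ : 0 < τ)
    (hτw : 0 < τw) (hR : ∀ s a k, |M.r s a k| ≤ R) (hR0 : 0 < R)
    (hR2 : R ^ 2 = τ * τw * (1 - M.γ) ^ 4 / 12) (hL : 0 ≤ L)
    (hπs : ∀ s, πs s = softmax fun a => M.softQ τ ws πs s a / τ)
    (hws : ws = softmax fun k => -M.value πs k / τw)
    {θ₀ : S × A → ℝ} {w₀ : Fin K → ℝ}
    (h0 : M.LogClose τ τw R πs ws L (softmaxPolicy θ₀) w₀ z ζ)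
    {ε η lam : ℝ} (hε : 0 < ε) (hε1 : ε < 1) (hη : η = ε * (1 - M.γ) / τ)
    (hlam : lam = ε ^ 2 / (τw * (1 - ε ^ 2))) (t : ℕ) :
    ∃ z ζ, M.LogClose τ τw R πs ws (L * (1 - (1 - M.γ) * ε ^ 2 / 4) ^ t)
      (softmaxPolicy (M.eram τ τw η lam θ₀ w₀ t).1) (M.eram τ τw η lam θ₀ w₀ t).2 z ζ := by
  have hρ : 0 ≤ 1 - (1 - M.γ) * ε ^ 2 / 4 := by
    have h1 := M.one_sub_γ_pos
    have h2 := M.γ_pos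
    have h3 : ε ^ 2 ≤ 1 := pow_le_one₀ hε.le hε1.le
    nlinarith
  induction t with
  | zero => exact ⟨z, ζ, by simpa [eram] using h0⟩
  | succ t ih =>
    obtain ⟨z, ζ, h⟩ := ih
    have hw : ∑ k, (M.eram τ τw η lam θ₀ w₀ t).2 k = 1 := by
      rw [h.weight_eq, softmax_sum]
    have h1 := h.step hτ hτw hR hR0 hR2 (mul_nonneg hL (pow_nonneg hρ t)) hπs hws hε hε1
      (M.softmaxPolicy_npgStep hreach hτ hη hw h.policy_eq)
      (M.weightStep_softmax hτw hε hε1 hlam (M.eram τ τw η lam θ₀ w₀ t).1 ζ)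
    rw [mul_assoc, ← pow_succ, ← h.weight_eq] at h1
    exact ⟨_, _, h1⟩

end MOMDP

end

/-! ### Conclusion. -/

theorem mainTheorem4 {S A : Type*} [Fintype S] [DecidableEq S] [Fintype A] [DecidableEq A]
    [Nonempty A] {K : ℕ} (M : MOMDP S A K) (hreach : M.AllReachable)
    (τ τw : ℝ) (hτ : 0 < τ) (hτw : 0 < τw)
    (hτw_large : 12 * (K : ℝ) * (M.rMax + τ * Real.log (Fintype.card A : ℝ)) ^ 2
      / (τ * (1 - M.γ) ^ 4) ≤ τw)
    (θ₀ : S × A → ℝ) (w₀ : Fin K → ℝ) (hw₀ : w₀ ∈ stdSimplex ℝ (Fin K))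
    (hw₀_pos : ∀ k, 0 < w₀ k)
    (θs : S × A → ℝ) (ws : Fin K → ℝ) (hNash : M.IsNash τ τw θs ws) :
    ∃ C : ℝ, 0 < C ∧
      ∀ ε : ℝ, 0 < ε → ε < 2 * (1 - M.γ) / (4 + 5 * M.γ - 6 * M.γ ^ 2) →
      ∀ εacc : ℝ, 0 < εacc → εacc ≤ 1 / 2 →
      ∀ η lam : ℝ, η = ε * (1 - M.γ) / τ → lam = ε ^ 2 / (τw * (1 - ε ^ 2)) →
      ∃ N : ℕ, (N : ℝ) ≤ C / ε ^ 2 * Real.log (1 / εacc) ∧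
        ∀ t : ℕ, N ≤ t →
          ∀ (θ : S × A → ℝ) (w : Fin K → ℝ), (θ, w) = M.eram τ τw η lam θ₀ w₀ t →
            (∀ s a, |Real.log (softmaxPolicy θs s a) - Real.log (softmaxPolicy θ s a)| ≤ εacc) ∧
            (∀ k, |ws k - w k| ≤ εacc) ∧
            (∀ s a, |M.softQ τ ws (softmaxPolicy θs) s a
              - M.softQ τ w (softmaxPolicy θ) s a| ≤ εacc) := by
  have hK : Nonempty (Fin K) := by
    by_contra hK
    rw [not_nonempty_iff] at hK
    simpa using hw₀.2
  have hK1 : (1 : ℝ) ≤ K := by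
    exact_mod_cast Fin.pos_iff_nonempty.2 hK
  have hg := M.one_sub_γ_pos
  have hγ := M.γ_pos
  -- `R` is the largest reward bound for which the coupling is contractive; the lower bound on `τw`
  -- is used to show `rMax ≤ R`.
  obtain ⟨R, hR⟩ : ∃ R, R = √(τ * τw * (1 - M.γ) ^ 4 / 12) := ⟨_, rfl⟩
  have hR0 : 0 < R := hR ▸ Real.sqrt_pos.2 (by positivity)
  have hR2 : R ^ 2 = τ * τw * (1 - M.γ) ^ 4 / 12 := hR ▸ Real.sq_sqrt (by positivity)
  have hrR : ∀ s a k, |M.r s a k| ≤ R := fun s a k => by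
    have hr0 : 0 ≤ M.rMax := (abs_nonneg _).trans (M.abs_r_le_rMax s a k)
    have hlog : 0 ≤ τ * Real.log (Fintype.card A : ℝ) := mul_nonneg hτ.le
      (Real.log_natCast_nonneg _)
    refine (M.abs_r_le_rMax s a k).trans ?_
    rw [hR]
    refine Real.le_sqrt_of_sq_le ?_
    rw [div_le_iff₀ (by positivity)] at hτw_large
    have h1 : M.rMax ^ 2 ≤ (M.rMax + τ * Real.log (Fintype.card A : ℝ)) ^ 2 :=
      pow_le_pow_left₀ hr0 (by linarith) 2
    have h2 : M.rMax ^ 2 ≤ K * (M.rMax + τ * Real.log (Fintype.card A : ℝ)) ^ 2 :=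
      h1.trans (le_mul_of_one_le_left (sq_nonneg _) hK1)
    linarith
  clear hτw_large
  have hπs := hNash.policy_eq M hreach hτ
  have hws := hNash.weight_eq M hτw
  obtain ⟨L, hL, h0⟩ := MOMDP.exists_logClose (M := M) (τw := τw) hτ hR0 θ₀ hw₀.2 hw₀_pos
    (softmaxPolicy θs) ws
  obtain ⟨C, hC, hN⟩ := exists_nat_forall_geometric_le
    -- The three summands convert `L` into errors of log-policy, weight and action value; the
    -- leading `1` ensures `1 ≤ G`.
    (G := 1 + L * (2 / τ + (1 - M.γ) ^ 2 / (4 * R) + 1)) (g := 1 - M.γ)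
    (by rw [le_add_iff_nonneg_right]; positivity) hg (by linarith)
  refine ⟨C, hC, fun ε hε hε0 εacc hacc hacc2 η lam hη hlam => ?_⟩
  -- The threshold is below `1` because `4 + 5γ - 6γ² - 2(1 - γ) = 2 + 7γ - 6γ²` is positive on `(0,
  -- 1)`.
  have hε1 : ε < 1 := by
    have hden : 0 < 4 + 5 * M.γ - 6 * M.γ ^ 2 := by clear hε0; nlinarith
    refine hε0.trans_le ((div_le_one hden).2 ?_)
    clear hε0
    nlinarith
  clear hε0
  obtain ⟨N, hNle, hNt⟩ := hN ε hε hε1 εacc hacc hacc2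
  refine ⟨N, hNle, fun t ht θ w hθw => ?_⟩
  obtain ⟨z, ζ, h⟩ := MOMDP.exists_logClose_eram hreach hτ hτw hrR hR0 hR2 hL hπs hws h0 hε hε1
    hη hlam t
  rw [← hθw] at h
  have hρ : 0 ≤ (1 - (1 - M.γ) * ε ^ 2 / 4) ^ t := pow_nonneg (by
    have h3 : ε ^ 2 ≤ 1 := pow_le_one₀ hε.le hε1.le
    nlinarith) t
  have hLt := mul_nonneg hL hρ
  have hbound : ∀ x y, 0 ≤ y → x + y ≤ 2 / τ + (1 - M.γ) ^ 2 / (4 * R) + 1 →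
      L * (1 - (1 - M.γ) * ε ^ 2 / 4) ^ t * x ≤ εacc := fun x y hy hx => by
    refine le_trans ?_ (hNt t ht)
    nlinarith [mul_le_mul_of_nonneg_left (show x ≤ 2 / τ + (1 - M.γ) ^ 2 / (4 * R) + 1 by linarith)
      hLt]
  have p1 : 0 ≤ 2 / τ := by positivity
  have p2 : 0 ≤ (1 - M.γ) ^ 2 / (4 * R) := by positivity
  refine ⟨fun s a => (h.abs_log_policy_sub_le hτ hπs s a).trans ?_, fun k => ?_, fun s a =>
    (h.abs_softQ_sub_le hτ hrR hR0 hLt hπs hws s a).trans ?_⟩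
  · refine le_trans (le_of_eq ?_) (hbound (2 / τ) _ (add_nonneg p2 zero_le_one) (by linarith))
    ring
  · refine (Finset.single_le_sum (f := fun k => |ws k - w k|) (fun _ _ => abs_nonneg _)
      (Finset.mem_univ k)).trans ((h.sum_abs_weight_sub_le hws).trans ?_)
    refine le_trans (le_of_eq ?_) (hbound _ _ (add_nonneg p1 zero_le_one) (by linarith))
    ring
  · exact hbound _ _ (add_nonneg p1 p2) (by linarith)
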